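/- **Setting.** Let $n\ge 3$, $m$ be integers, $\nu\in(0,1]$, and let $\Omega\subset\mathbb R^n$ be an open set (in particular, any domain). Let $A^{\alpha\beta}_{ij}$ ($1\le\alpha,\beta\le n$, $1\le i,j\le m$) be real measurable functions on $\mathbb R^n$ with $\sum A^{\alpha\beta}_{ij}(x)\xi^j_\beta\xi^i_\alpha\ge\nu|\xi|^2$ and $\sum|A^{\alpha\beta}_{ij}(x)|^2\le\nu^{-2}$ for all $x\in\mathbb R^n$, $\xi\in\mathbb R^{mn}$. Put $(Lu)^i=-D_\alpha(A^{\alpha\beta}_{ij}D_\beta u^j)$ (summation convention), and let ${}^tL$ be the adjoint operator, with coefficients ${}^tA^{\alpha\beta}_{ij}=A^{\beta\alpha}_{ji}$. For an open set $U$, $Y^{1,2}(U)$ is the space of $u\in L^{2n/(n-2)}(U)$ with weak gradient $Du\in L^2(U)$, normed by $\|u\|_{L^{2n/(n-2)}(U)}+\|Du\|_{L^2(U)}$, and $Y^{1,2}_0(U)$ is the closure of $C_c^\infty(U)$ in it. A function $u\in Y^{1,2}(U)$ *vanishes on* $\varSigma$ if it is a limit in $Y^{1,2}(U)$ of functions in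 $C_c^\infty(\overline U\setminus\varSigma)$ (restrictions to $\overline U$ of smooth functions, with compact support in $\overline U\setminus\varSigma$). $L^\infty_c(\Omega)$ is the set of $L^\infty(\Omega)$ functions with compact support in $\overline\Omega$. Write $\Omega_R(x)=\Omega\cap B_R(x)$ and $\varSigma_R(x)=\partial\Omega\cap B_R(x)$. **Green's matrix.** An $m\times m$ matrix valued function $G(x,y)$, defined for $x,y\in\Omega$, $x\ne y$, is a Green's matrix of $L$ in $\Omega$ if 1. for all $y\in\Omega$, $G(\cdot,y)\in W^{1,1}_{loc}(\Omega)$ and $\int_\Omega A^{\alpha\beta}_{ij}D_\beta G_{jk}(\cdot,y)D_\alpha\phi^i=\phi^k(y)$ for all $\phi\in C_c^\infty(\Omega)^m$ and all $k$; 2. for all $y\in\Omega$ and $r>0$, $G(\cdot,y)$ belongs to $Y^{1,2}(\Omega\setminus \overline{B_r(y)})$ and vanishes on $\partial\Omega$; 3. for every $f\in L^\infty_c(\Omega)^m$ the function $u_f(x)=\int_\Omega G(y,x)^Tf(y)\,dy$ belongs to $Y^{1,2}_0(\Omega)$ and satisfies ${}^tLu_f=f$ in $\Omega$ in the weak sense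 (with test functions in $C_c^\infty(\Omega)^m$). **Condition (LB)** with $R_{max}\in(0,\infty]$ and $N_0>0$: for all $x\in\Omega$, $R\in(0,R_{max})$ and $f\in L^\infty(\Omega_R(x))^m$, if $u\in W^{1,2}(\Omega_R(x))^m$ is a weak solution of $Lu=f$ or of ${}^tLu=f$ in $\Omega_R(x)$ and vanishes on $\varSigma_R(x)$, then $$\|u\|_{L^\infty(\Omega_{R/2}(x))}\le N_0\left(R^{-n/2}\|u\|_{L^2(\Omega_R(x))}+R^2\|f\|_{L^\infty(\Omega_R(x))}\right).$$ **Theorem.** There is a constant $C=C(n,m,\nu,N_0)>0$ such that, whenever (LB) holds with $R_{max}$ and $N_0$ and $G$ is a Green's matrix of $L$ in $\Omega$, the estimate $$|G(x,y)|\le C|x-y|^{2-n},\qquad x,y\in\Omega,\quad 0<|x-y|<R_{max},\qquad(*)$$ where $|\cdot|$ is the Euclidean norm on matrices, holds in the following sense: - (a) for almost every $y\in\Omega$, $(*)$ holds for almost every $x$; - (b) for every $y\in\Omega$ such that $u_f(y)=\lim_{\rho\to0}\frac1{|B_\rho(y)|}\int_{B_\rho(y)}u_f$ for all $f\in L^\infty_c(\Omega)^m$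 (in particular, if every $u_f$ is continuous at $y$), $(*)$ holds for almost every $x$; - (c) if $G$ is separately continuous off the diagonal (that is, $G(\cdot,y)$ is continuous on $\Omega\setminus\{y\}$ and $G(x,\cdot)$ is continuous on $\Omega\setminus\{x\}$ for all $x,y\in\Omega$), then $(*)$ holds for all $x$ and $y$. -/

import Mathlib

open MeasureTheory Filter Topology Metric Set
open scoped ENNReal ContDiff Matrix

namespace EllipticGreen

noncomputable section

/-- Euclidean space `ℝⁿ`; it serves as the ambient space of the domains (`n`) and as the space of
values of column vector valued functions (`m`). -/
abbrev E (n : ℕ) : Type := EuclideanSpace ℝ (Fin n)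

/-- Coefficients `A^{αβ}_{ij}(x)`, written `A α β i j x`. -/
abbrev Coeff (n m : ℕ) : Type := Fin n → Fin n → Fin m → Fin m → E n → ℝ

/-- Measurable coefficients on all of `ℝⁿ` with the strong ellipticity condition
`∑ A^{αβ}_{ij}(x) ξ^j_β ξ^i_α ≥ ν |ξ|²` and the bound `∑ |A^{αβ}_{ij}(x)|² ≤ ν⁻²`. -/
structure IsElliptic {n m : ℕ} (ν : ℝ) (A : Coeff n m) : Prop where
  measurable : ∀ α β i j, Measurable (A α β i j)
  elliptic : ∀ (x : E n) (ξ : Fin m → Fin n → ℝ),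
    ν * ∑ i, ∑ α, ξ i α ^ 2 ≤ ∑ i, ∑ j, ∑ α, ∑ β, A α β i j x * ξ j β * ξ i α
  bounded : ∀ x : E n, ∑ i, ∑ j, ∑ α, ∑ β, A α β i j x ^ 2 ≤ (ν ^ 2)⁻¹

/-- Coefficients of the adjoint operator: `ᵗA^{αβ}_{ij} = A^{βα}_{ji}`. -/
def adjointCoeff {n m : ℕ} (A : Coeff n m) : Coeff n m := fun α β i j => A β α j i

/-- The classical partial derivative `D_α φ (x)`. -/
def partialDeriv {n : ℕ} {V : Type*} [NormedAddCommGroup V] [NormedSpace ℝ V]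
    (α : Fin n) (φ : E n → V) (x : E n) : V :=
  fderiv ℝ φ x (EuclideanSpace.single α 1)

/-- `φ ∈ C^∞_c(Ω)`. -/
def IsTest {n : ℕ} {V : Type*} [NormedAddCommGroup V] [NormedSpace ℝ V]
    (Ω : Set (E n)) (φ : E n → V) : Prop :=
  ContDiff ℝ ∞ φ ∧ HasCompactSupport φ ∧ tsupport φ ⊆ Ω

/-- `φ ∈ C^∞_c(Ω̄ ∖ S)`: `φ` is smooth and the support of its restriction to `Ω̄` is a compact
subset of `Ω̄ ∖ S`. -/
def IsTestOffBoundaryPart {n : ℕ} {V : Type*} [NormedAddCommGroup V] [NormedSpace ℝ V]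
    (Ω S : Set (E n)) (φ : E n → V) : Prop :=
  ContDiff ℝ ∞ φ ∧ IsCompact (closure (Function.support φ ∩ closure Ω)) ∧
    closure (Function.support φ ∩ closure Ω) ⊆ closure Ω \ S

/-- `u ∈ L¹_loc(Ω)` has the functions `Du α ∈ L¹_loc(Ω)` as its weak partial derivatives in the
open set `Ω`. In particular, `∃ Du, HasWeakDeriv Ω u Du` says that `u ∈ W^{1,1}_loc(Ω)`. -/
structure HasWeakDeriv {n m : ℕ} (Ω : Set (E n)) (u : E n → E m) (Du : Fin n → E n → E m) :
    Prop where
  locallyIntegrable : LocallyIntegrableOn u Ω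
  locallyIntegrable_deriv : ∀ α, LocallyIntegrableOn (Du α) Ω
  integral_eq : ∀ (α : Fin n) (φ : E n → ℝ), IsTest Ω φ →
    ∫ x in Ω, partialDeriv α φ x • u x = - ∫ x in Ω, φ x • Du α x

/-- The Sobolev exponent `2n/(n-2)` (for `n ≥ 3`). -/
def sobolevExp (n : ℕ) : ℝ≥0∞ := ENNReal.ofReal (2 * (n : ℝ) / ((n : ℝ) - 2))

/-- `u ∈ W^{1,2}(Ω)` with weak derivatives `Du`. -/
def MemW12With {n m : ℕ} (Ω : Set (E n)) (u : E n → E m) (Du : Fin n → E n → E m) : Prop :=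
  HasWeakDeriv Ω u Du ∧ MemLp u 2 (volume.restrict Ω) ∧
    ∀ α, MemLp (Du α) 2 (volume.restrict Ω)

/-- `u ∈ Y^{1,2}(Ω)` with weak derivatives `Du`. -/
def MemY12With {n m : ℕ} (Ω : Set (E n)) (u : E n → E m) (Du : Fin n → E n → E m) : Prop :=
  HasWeakDeriv Ω u Du ∧ MemLp u (sobolevExp n) (volume.restrict Ω) ∧
    ∀ α, MemLp (Du α) 2 (volume.restrict Ω)

/-- The smooth functions `φ k` converge to `u` (with weak derivatives `Du`) in `Y^{1,2}(Ω)`. -/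
def TendstoY12 {n m : ℕ} (Ω : Set (E n)) (φ : ℕ → E n → E m) (u : E n → E m)
    (Du : Fin n → E n → E m) : Prop :=
  Tendsto (fun k => eLpNorm (fun x => φ k x - u x) (sobolevExp n) (volume.restrict Ω))
      atTop (𝓝 0) ∧
    ∀ α, Tendsto (fun k => eLpNorm (fun x => partialDeriv α (φ k) x - Du α x) 2
      (volume.restrict Ω)) atTop (𝓝 0)

/-- `u ∈ Y^{1,2}_0(Ω)`, the closure of `C^∞_c(Ω)` in `Y^{1,2}(Ω)`; `Du` are the weak derivatives. -/
def MemY120With {n m : ℕ} (Ω : Set (E n)) (u : E n → E m) (Du : Fin n → E n → E m) : Prop :=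
  MemY12With Ω u Du ∧ ∃ φ : ℕ → E n → E m, (∀ k, IsTest Ω (φ k)) ∧ TendstoY12 Ω φ u Du

/-- `u` belongs to `Y^{1,2}(Ω)` and vanishes on `S`: it is a limit in `Y^{1,2}(Ω)` of functions in
`C^∞_c(Ω̄ ∖ S)`. -/
def VanishesOn {n m : ℕ} (Ω S : Set (E n)) (u : E n → E m) : Prop :=
  ∃ Du : Fin n → E n → E m, MemY12With Ω u Du ∧
    ∃ φ : ℕ → E n → E m, (∀ k, IsTestOffBoundaryPart Ω S (φ k)) ∧ TendstoY12 Ω φ u Du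

/-- The bilinear form `∫_Ω A^{αβ}_{ij} D_β u^j D_α φ^i` (summed over `α, β, i, j`). -/
def bilinForm {n m : ℕ} (A : Coeff n m) (Ω : Set (E n)) (Du : Fin n → E n → E m)
    (φ : E n → E m) : ℝ :=
  ∫ x in Ω, ∑ i, ∑ j, ∑ α, ∑ β, A α β i j x * Du β x j * partialDeriv α φ x i

/-- With weak derivatives `Du` of `u`: `L u = f` in `Ω`, in the sense of distributions. -/
def SolvesWith {n m : ℕ} (A : Coeff n m) (Ω : Set (E n)) (Du : Fin n → E n → E m)
    (f : E n → E m) : Prop :=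
  ∀ φ : E n → E m, IsTest Ω φ → bilinForm A Ω Du φ = ∫ x in Ω, ∑ i, f x i * φ x i

/-- `u ∈ W^{1,2}(Ω)` is a weak solution of `L u = f` in `Ω`. -/
def IsWeakSolution {n m : ℕ} (A : Coeff n m) (Ω : Set (E n)) (f u : E n → E m) : Prop :=
  ∃ Du : Fin n → E n → E m, MemW12With Ω u Du ∧ SolvesWith A Ω Du f

/-- The local boundedness condition (LB) with the parameters `Rmax ∈ (0, ∞]` and `N₀`. -/
def ConditionLB {n m : ℕ} (A : Coeff n m) (Ω : Set (E n)) (Rmax : ℝ≥0∞) (N₀ : ℝ) : Prop :=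
  ∀ x ∈ Ω, ∀ R : ℝ, 0 < R → ENNReal.ofReal R < Rmax →
    ∀ f : E n → E m, MemLp f ∞ (volume.restrict (Ω ∩ ball x R)) →
    ∀ u : E n → E m,
      (IsWeakSolution A (Ω ∩ ball x R) f u ∨
        IsWeakSolution (adjointCoeff A) (Ω ∩ ball x R) f u) →
      VanishesOn (Ω ∩ ball x R) (frontier Ω ∩ ball x R) u →
      eLpNorm u ∞ (volume.restrict (Ω ∩ ball x (R / 2))) ≤
        ENNReal.ofReal N₀ *
          (ENNReal.ofReal (R ^ (-(n : ℝ) / 2)) * eLpNorm u 2 (volume.restrict (Ω ∩ ball x R)) +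
            ENNReal.ofReal (R ^ 2) * eLpNorm f ∞ (volume.restrict (Ω ∩ ball x R)))

/-- `f ∈ L^∞_c(Ω)`: essentially bounded on `Ω`, with compact support in `Ω̄`. -/
def MemLinftyC {n m : ℕ} (Ω : Set (E n)) (f : E n → E m) : Prop :=
  MemLp f ∞ (volume.restrict Ω) ∧ IsCompact (closure (Function.support f ∩ Ω))

/-- The `k`-th column of `G(·, y)`. -/
def greenColumn {n m : ℕ} (G : E n → E n → Matrix (Fin m) (Fin m) ℝ) (y : E n) (k : Fin m) :
    E n → E m :=
  fun x => WithLp.toLp 2 (fun i => G x y i k)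

/-- The potential `u(x) = ∫_Ω G(y, x)ᵀ f(y) dy`, i.e. `u^k(x) = ∫_Ω ∑ᵢ G_{ik}(y, x) f^i(y) dy`. -/
def greenPotential {n m : ℕ} (G : E n → E n → Matrix (Fin m) (Fin m) ℝ) (Ω : Set (E n))
    (f : E n → E m) : E n → E m :=
  fun x => WithLp.toLp 2 (fun k => ∫ y in Ω, ∑ i, G y x i k * f y i)

/-- `G` is a Green's matrix of `L` in `Ω`. Only the values `G x y` with `x, y ∈ Ω`, `x ≠ y`
matter. -/
structure IsGreenMatrix {n m : ℕ} (A : Coeff n m) (Ω : Set (E n))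
    (G : E n → E n → Matrix (Fin m) (Fin m) ℝ) : Prop where
  /-- `G(·, y) ∈ W^{1,1}_loc(Ω)` and `L G(·, y) = δ_y I`. -/
  fundamental : ∀ y ∈ Ω, ∀ k : Fin m, ∃ D : Fin n → E n → E m,
    HasWeakDeriv Ω (greenColumn G y k) D ∧
      ∀ φ : E n → E m, IsTest Ω φ → bilinForm A Ω D φ = φ y k
  /-- `G(·, y) ∈ Y^{1,2}(Ω ∖ B_r(y))` for every `r > 0`, and it vanishes on `∂Ω`. -/
  vanishes : ∀ y ∈ Ω, ∀ r : ℝ, 0 < r → ∀ k : Fin m,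
    VanishesOn (Ω \ closedBall y r) (frontier Ω) (greenColumn G y k)
  /-- The potential of `f ∈ L^∞_c(Ω)` is a function in `Y^{1,2}_0(Ω)` that solves the adjoint
  system with right-hand side `f`. -/
  potential : ∀ f : E n → E m, MemLinftyC Ω f → ∃ Du : Fin n → E n → E m,
    MemY120With Ω (greenPotential G Ω f) Du ∧ SolvesWith (adjointCoeff A) Ω Du f

/-- The Euclidean norm `|M| = (∑ |M_{ij}|²)^{1/2}` of a matrix. -/
def matrixNorm {m : ℕ} (M : Matrix (Fin m) (Fin m) ℝ) : ℝ :=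
  Real.sqrt (∑ i, ∑ j, M i j ^ 2)

/-- Every potential of a function in `L^∞_c(Ω)` has at the point `y` the value that its mean values
over small balls around `y` determine. -/
def IsPreciseAt {n m : ℕ} (G : E n → E n → Matrix (Fin m) (Fin m) ℝ) (Ω : Set (E n))
    (y : E n) : Prop :=
  ∀ f : E n → E m, MemLinftyC Ω f →
    Tendsto (fun ρ : ℝ => ⨍ z in ball y ρ, greenPotential G Ω f z) (𝓝[>] 0)
      (𝓝 (greenPotential G Ω f y))

/-- `G` is separately continuous off the diagonal of `Ω × Ω`. -/
def IsSeparatelyContinuous {n m : ℕ} (G : E n → E n → Matrix (Fin m) (Fin m) ℝ)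
    (Ω : Set (E n)) : Prop :=
  (∀ y ∈ Ω, ContinuousOn (fun x => G x y) (Ω \ {y})) ∧
    ∀ x ∈ Ω, ContinuousOn (fun y => G x y) (Ω \ {x})

end

end EllipticGreen

namespace EllipticGreen

section Restriction

theorem partialDeriv_of_notMem_tsupport {n : ℕ} {V : Type*} [NormedAddCommGroup V]
    [NormedSpace ℝ V] {φ : E n → V} {x : E n} (hx : x ∉ tsupport φ) (α : Fin n) :
    partialDeriv α φ x = 0 := by
  simp [partialDeriv, fderiv_of_notMem_tsupport ℝ hx]

theorem IsTest.mono {n : ℕ} {V : Type*} [NormedAddCommGroup V] [NormedSpace ℝ V]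
    {Ω U : Set (E n)} {φ : E n → V} (h : IsTest U φ) (hU : U ⊆ Ω) : IsTest Ω φ :=
  ⟨h.1, h.2.1, h.2.2.trans hU⟩

theorem setIntegral_eq_setIntegral_of_subset {n : ℕ} {V : Type*} [NormedAddCommGroup V]
    [NormedSpace ℝ V] {Ω U : Set (E n)} {f : E n → V} (hU : U ⊆ Ω) (hf : ∀ x ∉ U, f x = 0) :
    ∫ x in U, f x = ∫ x in Ω, f x := by
  rw [setIntegral_eq_integral_of_forall_compl_eq_zero hf,
    setIntegral_eq_integral_of_forall_compl_eq_zero fun x hx => hf x fun h => hx (hU h)]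

theorem HasWeakDeriv.mono {n m : ℕ} {Ω U : Set (E n)} {u : E n → E m} {Du : Fin n → E n → E m}
    (h : HasWeakDeriv Ω u Du) (hU : U ⊆ Ω) : HasWeakDeriv U u Du where
  locallyIntegrable := h.locallyIntegrable.mono_set hU
  locallyIntegrable_deriv α := (h.locallyIntegrable_deriv α).mono_set hU
  integral_eq α φ hφ := by
    rw [setIntegral_eq_setIntegral_of_subset hU, setIntegral_eq_setIntegral_of_subset hU,
      h.integral_eq α φ (hφ.mono hU)]
    · intro x hx
      simp [image_eq_zero_of_notMem_tsupport fun h => hx (hφ.2.2 h)]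
    · intro x hx
      simp [partialDeriv_of_notMem_tsupport fun h => hx (hφ.2.2 h)]

theorem IsTest.integrable_smul {n m : ℕ} {U : Set (E n)} {φ : E n → ℝ} {v : E n → E m}
    (hφ : IsTest U φ) (hv : LocallyIntegrableOn v U) : Integrable fun x => φ x • v x := by
  have h1 : IntegrableOn (fun x => φ x • v x) (tsupport φ) :=
    (hv.integrableOn_compact_subset hφ.2.2 hφ.2.1).continuousOn_smul hφ.1.continuous.continuousOn
      hφ.2.1
  refine (integrableOn_iff_integrable_of_support_subset ?_).1 h1
  exact (Function.support_smul_subset_left _ _).trans (subset_tsupport φ)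

theorem HasWeakDeriv.ae_unique {n m : ℕ} {U : Set (E n)} (hU : IsOpen U) {u : E n → E m}
    {D D' : Fin n → E n → E m} (h : HasWeakDeriv U u D) (h' : HasWeakDeriv U u D') (α : Fin n) :
    D α =ᵐ[volume.restrict U] D' α := by
  rw [Filter.EventuallyEq, ae_restrict_iff' hU.measurableSet]
  have := hU.ae_eq_zero_of_integral_contDiff_smul_eq_zero (μ := volume)
    ((h.locallyIntegrable_deriv α).sub (h'.locallyIntegrable_deriv α)) ?_
  · filter_upwards [this] with x hx hxU
    exact sub_eq_zero.1 (hx hxU)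
  · intro g hg hgc hgs
    have hφ : IsTest U g := ⟨hg, hgc, hgs⟩
    have key : ∫ x in U, g x • D α x = ∫ x in U, g x • D' α x := by
      rw [← neg_inj, ← h.integral_eq α g hφ, h'.integral_eq α g hφ]
    have hz : ∀ (v : E n → E m), ∫ x in U, g x • v x = ∫ x, g x • v x := fun v =>
      setIntegral_eq_integral_of_forall_compl_eq_zero fun x hx => by
        simp [image_eq_zero_of_notMem_tsupport fun h => hx (hgs h)]
    rw [hz, hz] at key
    simp only [Pi.sub_apply, smul_sub]
    rw [integral_sub (hφ.integrable_smul (h.locallyIntegrable_deriv α))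
      (hφ.integrable_smul (h'.locallyIntegrable_deriv α)), key, sub_self]

theorem bilinForm_mono {n m : ℕ} (A : Coeff n m) {Ω U : Set (E n)} (hU : U ⊆ Ω)
    (D : Fin n → E n → E m) {φ : E n → E m} (hφ : IsTest U φ) :
    bilinForm A U D φ = bilinForm A Ω D φ := by
  refine setIntegral_eq_setIntegral_of_subset hU fun x hx => ?_
  simp [partialDeriv_of_notMem_tsupport fun h => hx (hφ.2.2 h)]

theorem bilinForm_congr {n m : ℕ} (A : Coeff n m) {U : Set (E n)} {D D' : Fin n → E n → E m}
    (h : ∀ α, D α =ᵐ[volume.restrict U] D' α) (φ : E n → E m) :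
    bilinForm A U D φ = bilinForm A U D' φ := by
  refine integral_congr_ae ?_
  filter_upwards [ae_all_iff.2 h] with x hx
  simp only [hx]

theorem MemY12With.mono {n m : ℕ} {Ω U : Set (E n)} {u : E n → E m} {Du : Fin n → E n → E m}
    (h : MemY12With Ω u Du) (hU : U ⊆ Ω) : MemY12With U u Du :=
  ⟨h.1.mono hU, h.2.1.mono_measure (Measure.restrict_mono_set _ hU),
    fun α => (h.2.2 α).mono_measure (Measure.restrict_mono_set _ hU)⟩

theorem TendstoY12.mono {n m : ℕ} {Ω U : Set (E n)} {φ : ℕ → E n → E m} {u : E n → E m}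
    {Du : Fin n → E n → E m} (h : TendstoY12 Ω φ u Du) (hU : U ⊆ Ω) : TendstoY12 U φ u Du :=
  ⟨tendsto_of_tendsto_of_tendsto_of_le_of_le tendsto_const_nhds h.1 (fun _ => zero_le)
      fun _ => eLpNorm_mono_measure _ (Measure.restrict_mono_set _ hU),
    fun α => tendsto_of_tendsto_of_tendsto_of_le_of_le tendsto_const_nhds (h.2 α)
      (fun _ => zero_le) fun _ => eLpNorm_mono_measure _ (Measure.restrict_mono_set _ hU)⟩

theorem IsTestOffBoundaryPart.mono {n m : ℕ} {Ω U S T : Set (E n)} {φ : E n → E m}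
    (h : IsTestOffBoundaryPart Ω S φ) (hU : U ⊆ Ω) (hT : T ⊆ S) :
    IsTestOffBoundaryPart U T φ := by
  have hsub : closure (Function.support φ ∩ closure U) ⊆
      closure (Function.support φ ∩ closure Ω) :=
    closure_mono (inter_subset_inter_right _ (closure_mono hU))
  refine ⟨h.1, h.2.1.of_isClosed_subset isClosed_closure hsub, fun x hx => ⟨?_, fun hxT => ?_⟩⟩
  · exact closure_minimal inter_subset_right isClosed_closure hx
  · exact (h.2.2 (hsub hx)).2 (hT hxT)

theorem VanishesOn.mono {n m : ℕ} {Ω U S T : Set (E n)} {u : E n → E m}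
    (h : VanishesOn Ω S u) (hU : U ⊆ Ω) (hT : T ⊆ S) : VanishesOn U T u := by
  obtain ⟨Du, h1, φ, h2, h3⟩ := h
  exact ⟨Du, h1.mono hU, φ, fun k => (h2 k).mono hU hT, h3.mono hU⟩

theorem IsTest.isTestOffBoundaryPart {n m : ℕ} {Ω : Set (E n)} (hΩ : IsOpen Ω) {φ : E n → E m}
    (h : IsTest Ω φ) : IsTestOffBoundaryPart Ω (frontier Ω) φ := by
  have hsub : closure (Function.support φ ∩ closure Ω) ⊆ tsupport φ :=
    closure_mono inter_subset_left
  refine ⟨h.1, h.2.1.of_isClosed_subset isClosed_closure hsub, fun x hx => ?_⟩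
  have hxΩ := h.2.2 (hsub hx)
  exact ⟨subset_closure hxΩ, fun hf => (hΩ.frontier_eq ▸ hf).2 hxΩ⟩

theorem MemY120With.vanishesOn {n m : ℕ} {Ω : Set (E n)} (hΩ : IsOpen Ω) {u : E n → E m}
    {Du : Fin n → E n → E m} (h : MemY120With Ω u Du) : VanishesOn Ω (frontier Ω) u := by
  obtain ⟨h1, φ, h2, h3⟩ := h
  exact ⟨Du, h1, φ, fun k => (h2 k).isTestOffBoundaryPart hΩ, h3⟩

theorem SolvesWith.mono {n m : ℕ} {A : Coeff n m} {Ω U : Set (E n)} {Du : Fin n → E n → E m}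
    {f g : E n → E m} (h : SolvesWith A Ω Du f) (hU : U ⊆ Ω) (hfg : ∀ x ∈ U, f x = g x) :
    SolvesWith A U Du g := by
  intro φ hφ
  rw [bilinForm_mono A hU Du hφ, h φ (hφ.mono hU)]
  have hz : ∀ x ∉ U, φ x = 0 := fun x hx =>
    image_eq_zero_of_notMem_tsupport fun h => hx (hφ.2.2 h)
  rw [setIntegral_eq_setIntegral_of_subset hU fun x hx => by simp [hz x hx]]
  congr 1
  ext x
  by_cases hx : x ∈ U
  · rw [hfg x hx]
  · simp [hz x hx]

end Restriction

end EllipticGreen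

namespace EllipticGreen

section LebesgueNorms

theorem abs_integral_inner_le {X V : Type*} [MeasurableSpace X] {μ : Measure X}
    [NormedAddCommGroup V] [InnerProductSpace ℝ V] {f g : X → V} (hf : MemLp f 2 μ)
    (hg : MemLp g 2 μ) :
    |∫ x, inner ℝ (f x) (g x) ∂μ| ≤ (eLpNorm f 2 μ).toReal * (eLpNorm g 2 μ).toReal := by
  have h := abs_real_inner_le_norm (hf.toLp f) (hg.toLp g)
  rw [L2.inner_def, Lp.norm_toLp, Lp.norm_toLp] at h
  convert h using 2
  refine integral_congr_ae ?_
  filter_upwards [hf.coeFn_toLp, hg.coeFn_toLp] with x h1 h2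
  rw [h1, h2]

theorem integrable_inner_of_memLp {X V : Type*} [MeasurableSpace X] {μ : Measure X}
    [NormedAddCommGroup V] [InnerProductSpace ℝ V] {f g : X → V} (hf : MemLp f 2 μ)
    (hg : MemLp g 2 μ) : Integrable (fun x => inner ℝ (f x) (g x)) μ := by
  refine (L2.integrable_inner (𝕜 := ℝ) (hf.toLp f) (hg.toLp g)).congr ?_
  filter_upwards [hf.coeFn_toLp, hg.coeFn_toLp] with x h1 h2
  rw [h1, h2]

theorem sq_eLpNorm_two_toReal {X V : Type*} [MeasurableSpace X] {μ : Measure X}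
    [NormedAddCommGroup V] [InnerProductSpace ℝ V] {f : X → V} (hf : MemLp f 2 μ) :
    (eLpNorm f 2 μ).toReal ^ 2 = ∫ x, ‖f x‖ ^ 2 ∂μ := by
  have h := real_inner_self_eq_norm_sq (hf.toLp f)
  rw [L2.inner_def, Lp.norm_toLp] at h
  rw [← h]
  refine integral_congr_ae ?_
  filter_upwards [hf.coeFn_toLp] with x h1
  rw [h1, real_inner_self_eq_norm_sq]

theorem two_le_sobolevExp {n : ℕ} (hn : 3 ≤ n) : 2 ≤ sobolevExp n := by
  have hn' : (3 : ℝ) ≤ n := by exact_mod_cast hn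
  rw [sobolevExp, ← ENNReal.ofReal_ofNat 2]
  refine ENNReal.ofReal_le_ofReal ?_
  rw [le_div_iff₀ (by linarith)]
  linarith

theorem toReal_sobolevExp {n : ℕ} (hn : 3 ≤ n) :
    (sobolevExp n).toReal = 2 * (n : ℝ) / ((n : ℝ) - 2) := by
  have hn' : (3 : ℝ) ≤ n := by exact_mod_cast hn
  exact ENNReal.toReal_ofReal (div_nonneg (by linarith) (by linarith))

/-- The `n`-th root of the volume of the unit ball. -/
noncomputable def unitBallConst (n : ℕ) : ℝ := (volume (ball (0 : E n) 1)).toReal ^ (n : ℝ)⁻¹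

theorem unitBallConst_nonneg (n : ℕ) : 0 ≤ unitBallConst n :=
  Real.rpow_nonneg ENNReal.toReal_nonneg _

theorem eLpNorm_two_le_sobolevExp {n m : ℕ} (hn : 3 ≤ n) {U : Set (E n)} {x : E n} {r : ℝ}
    (hr : 0 < r) (hU : U ⊆ ball x r) {u : E n → E m}
    (hu : AEStronglyMeasurable u (volume.restrict U)) :
    eLpNorm u 2 (volume.restrict U) ≤
      ENNReal.ofReal (unitBallConst n * r) * eLpNorm u (sobolevExp n) (volume.restrict U) := by
  have hn' : (3 : ℝ) ≤ n := by exact_mod_cast hn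
  have : NeZero n := ⟨by omega⟩
  refine (eLpNorm_le_eLpNorm_mul_rpow_measure_univ (two_le_sobolevExp hn) hu).trans ?_
  rw [mul_comm]
  refine mul_le_mul_left ?_ _
  have hexp : (1 / (2 : ℝ≥0∞).toReal - 1 / (sobolevExp n).toReal) = (n : ℝ)⁻¹ := by
    rw [toReal_sobolevExp hn]
    have h1 : (n : ℝ) - 2 ≠ 0 := by linarith
    have h2 : (n : ℝ) ≠ 0 := by linarith
    simp only [ENNReal.toReal_ofNat]
    field_simp
    ring
  rw [hexp, Measure.restrict_apply_univ]
  have hfin : volume (ball (0 : E n) 1) ≠ ⊤ := measure_ball_lt_top.ne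
  calc volume U ^ (n : ℝ)⁻¹
      ≤ (ENNReal.ofReal (r ^ n) * volume (ball (0 : E n) 1)) ^ (n : ℝ)⁻¹ := by
        refine ENNReal.rpow_le_rpow ?_ (by positivity)
        refine (measure_mono hU).trans ?_
        rw [Measure.addHaar_ball _ _ hr.le, finrank_euclideanSpace_fin]
    _ = ENNReal.ofReal (unitBallConst n * r) := by
        rw [← ENNReal.ofReal_toReal hfin, ← ENNReal.ofReal_mul (by positivity),
          ENNReal.ofReal_rpow_of_nonneg (by positivity) (by positivity),
          Real.mul_rpow (by positivity) ENNReal.toReal_nonneg, ← Real.rpow_natCast,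
          ← Real.rpow_mul hr.le, mul_inv_cancel₀ (by linarith), Real.rpow_one, mul_comm,
          unitBallConst]

theorem MemLp.two_of_sobolevExp {n m : ℕ} (hn : 3 ≤ n) {U : Set (E n)} {x : E n} {r : ℝ}
    (hU : U ⊆ ball x r) {u : E n → E m}
    (hu : MemLp u (sobolevExp n) (volume.restrict U)) : MemLp u 2 (volume.restrict U) := by
  have : IsFiniteMeasure (volume.restrict U) :=
    ⟨by rw [Measure.restrict_apply_univ]; exact (measure_mono hU).trans_lt measure_ball_lt_top⟩
  exact hu.mono_exponent (two_le_sobolevExp hn)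

theorem MemY12With.memW12With {n m : ℕ} (hn : 3 ≤ n) {U : Set (E n)} {x : E n} {r : ℝ}
    (hU : U ⊆ ball x r) {u : E n → E m} {Du : Fin n → E n → E m} (h : MemY12With U u Du) :
    MemW12With U u Du :=
  ⟨h.1, MemLp.two_of_sobolevExp hn hU h.2.1, h.2.2⟩

end LebesgueNorms

section Sobolev

theorem norm_fderiv_le_sum_partialDeriv {n : ℕ} {V : Type*} [NormedAddCommGroup V]
    [NormedSpace ℝ V] (φ : E n → V) (x : E n) :
    ‖fderiv ℝ φ x‖ ≤ ∑ α, ‖partialDeriv α φ x‖ := by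
  refine ContinuousLinearMap.opNorm_le_bound _ (by positivity) fun v => ?_
  have hv : v = ∑ α, v α • EuclideanSpace.single α (1 : ℝ) := by
    ext i
    simp [Finset.sum_apply, Pi.single_apply]
  conv_lhs => rw [hv]
  rw [map_sum, Finset.sum_mul]
  refine norm_sum_le_of_le _ fun α _ => ?_
  rw [map_smul, norm_smul, mul_comm]
  exact mul_le_mul_of_nonneg_left (PiLp.norm_apply_le v α) (norm_nonneg _)

theorem IsTest.continuous_partialDeriv {n : ℕ} {V : Type*} [NormedAddCommGroup V]
    [NormedSpace ℝ V] {Ω : Set (E n)} {φ : E n → V} (h : IsTest Ω φ) (α : Fin n) :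
    Continuous (partialDeriv α φ) :=
  (h.1.continuous_fderiv (by simp)).clm_apply continuous_const

theorem IsTest.hasCompactSupport_partialDeriv {n : ℕ} {V : Type*} [NormedAddCommGroup V]
    [NormedSpace ℝ V] {Ω : Set (E n)} {φ : E n → V} (h : IsTest Ω φ) (α : Fin n) :
    HasCompactSupport (partialDeriv α φ) := by
  refine HasCompactSupport.intro h.2.1 fun x hx => ?_
  exact partialDeriv_of_notMem_tsupport hx α

theorem IsTest.memLp_partialDeriv {n : ℕ} {V : Type*} [NormedAddCommGroup V]
    [NormedSpace ℝ V] {Ω : Set (E n)} {φ : E n → V} (h : IsTest Ω φ) (α : Fin n) (p : ℝ≥0∞)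
    (μ : Measure (E n)) [IsFiniteMeasureOnCompacts μ] : MemLp (partialDeriv α φ) p μ :=
  (h.continuous_partialDeriv α).memLp_of_hasCompactSupport (h.hasCompactSupport_partialDeriv α)

theorem IsTest.memLp {n : ℕ} {V : Type*} [NormedAddCommGroup V]
    [NormedSpace ℝ V] {Ω : Set (E n)} {φ : E n → V} (h : IsTest Ω φ) (p : ℝ≥0∞)
    (μ : Measure (E n)) [IsFiniteMeasureOnCompacts μ] : MemLp φ p μ :=
  h.1.continuous.memLp_of_hasCompactSupport h.2.1

/-- The constant of the Sobolev inequality on `ℝⁿ` for functions with values in `ℝᵐ`. -/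
noncomputable def sobolevConst (n m : ℕ) : ℝ :=
  SNormLESNormFDerivOfEqConst (E m) (volume : Measure (E n)) 2

theorem sobolevConst_nonneg (n m : ℕ) : 0 ≤ sobolevConst n m := NNReal.coe_nonneg _

theorem IsTest.eLpNorm_sobolevExp_le {n m : ℕ} (hn : 3 ≤ n) {Ω : Set (E n)} {φ : E n → E m}
    (h : IsTest Ω φ) :
    eLpNorm φ (sobolevExp n) (volume.restrict Ω) ≤
      ENNReal.ofReal (sobolevConst n m) *
        ∑ α, eLpNorm (partialDeriv α φ) 2 (volume.restrict Ω) := by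
  have hn' : (3 : ℝ) ≤ n := by exact_mod_cast hn
  have hs : Function.support φ ⊆ Ω := (subset_tsupport φ).trans h.2.2
  have hs' : ∀ α, Function.support (partialDeriv α φ) ⊆ Ω := fun α x hx => by
    by_contra hxΩ
    exact hx (partialDeriv_of_notMem_tsupport (fun h' => hxΩ (h.2.2 h')) α)
  rw [eLpNorm_restrict_eq_of_support_subset hs]
  simp_rw [eLpNorm_restrict_eq_of_support_subset (hs' _)]
  have key := eLpNorm_le_eLpNorm_fderiv_of_eq (volume : Measure (E n)) (u := φ)
    (h.1.of_le (by simp)) h.2.1 (p := 2) (p' := (2 * (n : ℝ) / ((n : ℝ) - 2)).toNNReal)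
    (by norm_num) (by rw [finrank_euclideanSpace_fin]; omega) (by
      rw [finrank_euclideanSpace_fin, Real.coe_toNNReal _
        (div_nonneg (by linarith) (by linarith))]
      have h1 : (n : ℝ) - 2 ≠ 0 := by linarith
      have h2 : (n : ℝ) ≠ 0 := by linarith
      push_cast
      field_simp
      )
  refine key.trans ?_
  have hc : ((SNormLESNormFDerivOfEqConst (E m) (volume : Measure (E n)) ((2 : NNReal) : ℝ) :
      NNReal) : ℝ≥0∞) = ENNReal.ofReal (sobolevConst n m) := by
    rw [sobolevConst, ENNReal.ofReal_coe_nnreal]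
    rfl
  rw [hc]
  refine mul_le_mul_right ?_ _
  calc eLpNorm (fderiv ℝ φ) ((2 : NNReal) : ℝ≥0∞) volume
      ≤ eLpNorm (fun x => ∑ α, ‖partialDeriv α φ x‖) 2 volume := by
        refine eLpNorm_mono_real fun x => ?_
        exact norm_fderiv_le_sum_partialDeriv φ x
    _ = eLpNorm (∑ α, fun x => ‖partialDeriv α φ x‖) 2 volume := by
        congr 1
        ext x
        simp
    _ ≤ ∑ α, eLpNorm (fun x => ‖partialDeriv α φ x‖) 2 volume :=
        eLpNorm_sum_le (fun α _ => (h.continuous_partialDeriv α).norm.aestronglyMeasurable)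
          (by norm_num)
    _ = ∑ α, eLpNorm (partialDeriv α φ) 2 volume := by simp_rw [eLpNorm_norm]

theorem tendsto_eLpNorm_of_tendsto_sub {X V : Type*} [MeasurableSpace X] [NormedAddCommGroup V]
    {μ : Measure X} {p : ℝ≥0∞} (hp : 1 ≤ p) {f : ℕ → X → V} {g : X → V}
    (hf : ∀ k, MemLp (f k) p μ) (hg : MemLp g p μ)
    (h : Tendsto (fun k => eLpNorm (fun x => f k x - g x) p μ) atTop (𝓝 0)) :
    Tendsto (fun k => eLpNorm (f k) p μ) atTop (𝓝 (eLpNorm g p μ)) := by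
  have hup : Tendsto (fun k => eLpNorm g p μ + eLpNorm (fun x => f k x - g x) p μ) atTop
      (𝓝 (eLpNorm g p μ)) := by simpa using tendsto_const_nhds.add h
  have hlow : Tendsto (fun k => eLpNorm g p μ - eLpNorm (fun x => f k x - g x) p μ) atTop
      (𝓝 (eLpNorm g p μ)) := by
    simpa using ENNReal.Tendsto.sub tendsto_const_nhds h (Or.inl hg.2.ne)
  refine tendsto_of_tendsto_of_tendsto_of_le_of_le hlow hup (fun k => ?_) fun k => ?_
  · refine tsub_le_iff_right.2 ?_
    have hs := eLpNorm_sub_le (hf k).1 ((hf k).sub hg).1 hp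
    have he : f k - (f k - g) = g := by simp
    rw [he] at hs
    exact hs
  · have hs := eLpNorm_add_le hg.1 ((hf k).sub hg).1 hp
    have he : g + (f k - g) = f k := by simp
    rw [he] at hs
    exact hs

theorem TendstoY12.eLpNorm_tendsto {n m : ℕ} (hn : 3 ≤ n) {Ω : Set (E n)} {φ : ℕ → E n → E m}
    {u : E n → E m} {Du : Fin n → E n → E m} (hu : MemY12With Ω u Du)
    (hφ : ∀ k, IsTest Ω (φ k)) (h : TendstoY12 Ω φ u Du) :
    Tendsto (fun k => eLpNorm (φ k) (sobolevExp n) (volume.restrict Ω)) atTop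
      (𝓝 (eLpNorm u (sobolevExp n) (volume.restrict Ω))) :=
  tendsto_eLpNorm_of_tendsto_sub (one_le_two.trans (two_le_sobolevExp hn))
    (fun k => (hφ k).memLp _ _) hu.2.1 h.1

theorem TendstoY12.eLpNorm_partialDeriv_tendsto {n m : ℕ} {Ω : Set (E n)} {φ : ℕ → E n → E m}
    {u : E n → E m} {Du : Fin n → E n → E m} (hu : MemY12With Ω u Du)
    (hφ : ∀ k, IsTest Ω (φ k)) (h : TendstoY12 Ω φ u Du) (α : Fin n) :
    Tendsto (fun k => eLpNorm (partialDeriv α (φ k)) 2 (volume.restrict Ω)) atTop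
      (𝓝 (eLpNorm (Du α) 2 (volume.restrict Ω))) :=
  tendsto_eLpNorm_of_tendsto_sub one_le_two
    (fun k => (hφ k).memLp_partialDeriv α _ _) (hu.2.2 α) (h.2 α)

theorem MemY120With.eLpNorm_sobolevExp_le {n m : ℕ} (hn : 3 ≤ n) {Ω : Set (E n)} {u : E n → E m}
    {Du : Fin n → E n → E m} (h : MemY120With Ω u Du) :
    eLpNorm u (sobolevExp n) (volume.restrict Ω) ≤
      ENNReal.ofReal (sobolevConst n m) * ∑ α, eLpNorm (Du α) 2 (volume.restrict Ω) := by
  obtain ⟨h1, φ, hφ, h3⟩ := h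
  refine le_of_tendsto_of_tendsto' (h3.eLpNorm_tendsto hn h1 hφ) ?_
    fun k => (hφ k).eLpNorm_sobolevExp_le hn
  refine ENNReal.Tendsto.const_mul ?_ (Or.inr ENNReal.ofReal_ne_top)
  exact tendsto_finsetSum _ fun α _ => h3.eLpNorm_partialDeriv_tendsto h1 hφ α

end Sobolev

end EllipticGreen

namespace EllipticGreen

section Energy

/-- The flux `A^{αβ}_{ij} D_β u^j`. -/
noncomputable def flux {n m : ℕ} (A : Coeff n m) (Du : Fin n → E n → E m) (α : Fin n) :
    E n → E m :=
  fun x => WithLp.toLp 2 fun i => ∑ j, ∑ β, A α β i j x * Du β x j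

theorem inner_eq_sum {m : ℕ} (v w : E m) : inner ℝ v w = ∑ i, v i * w i := by
  simp [PiLp.inner_apply, mul_comm]

theorem sum_inner_flux {n m : ℕ} (A : Coeff n m) (Du : Fin n → E n → E m) (w : Fin n → E m)
    (x : E n) :
    ∑ α, inner ℝ (flux A Du α x) (w α) =
      ∑ i, ∑ j, ∑ α, ∑ β, A α β i j x * Du β x j * w α i := by
  simp_rw [inner_eq_sum, flux, Finset.sum_mul]
  rw [Finset.sum_comm]
  refine Finset.sum_congr rfl fun i _ => ?_
  rw [Finset.sum_comm]

theorem bilinForm_eq_integral_flux {n m : ℕ} (A : Coeff n m) (Ω : Set (E n))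
    (Du : Fin n → E n → E m) (φ : E n → E m) :
    bilinForm A Ω Du φ = ∫ x in Ω, ∑ α, inner ℝ (flux A Du α x) (partialDeriv α φ x) := by
  simp_rw [sum_inner_flux]
  rfl

theorem IsElliptic.abs_le {n m : ℕ} {ν : ℝ} {A : Coeff n m} (hA : IsElliptic ν A)
    (α β : Fin n) (i j : Fin m) (x : E n) : |A α β i j x| ≤ Real.sqrt (ν ^ 2)⁻¹ := by
  refine Real.abs_le_sqrt (le_trans ?_ (hA.bounded x))
  calc A α β i j x ^ 2 ≤ ∑ β, A α β i j x ^ 2 :=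
        Finset.single_le_sum (f := fun β => A α β i j x ^ 2) (fun _ _ => sq_nonneg _)
          (Finset.mem_univ β)
    _ ≤ ∑ α, ∑ β, A α β i j x ^ 2 :=
        Finset.single_le_sum (f := fun α => ∑ β, A α β i j x ^ 2)
          (fun _ _ => by positivity) (Finset.mem_univ α)
    _ ≤ ∑ j, ∑ α, ∑ β, A α β i j x ^ 2 :=
        Finset.single_le_sum (f := fun j => ∑ α, ∑ β, A α β i j x ^ 2)
          (fun _ _ => by positivity) (Finset.mem_univ j)
    _ ≤ ∑ i, ∑ j, ∑ α, ∑ β, A α β i j x ^ 2 :=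
        Finset.single_le_sum (f := fun i => ∑ j, ∑ α, ∑ β, A α β i j x ^ 2)
          (fun _ _ => by positivity) (Finset.mem_univ i)

theorem IsElliptic.memLp_flux {n m : ℕ} {ν : ℝ} {A : Coeff n m} (hA : IsElliptic ν A)
    {μ : Measure (E n)} {Du : Fin n → E n → E m} (hDu : ∀ α, MemLp (Du α) 2 μ) (α : Fin n) :
    MemLp (flux A Du α) 2 μ := by
  refine MemLp.of_eval_piLp fun i => ?_
  change MemLp (fun x => ∑ j, ∑ β, A α β i j x * Du β x j) 2 μ
  refine memLp_finsetSum _ fun j _ => memLp_finsetSum _ fun β _ => ?_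
  have hj := (hDu β).eval_piLp j
  refine hj.of_le_mul (c := Real.sqrt (ν ^ 2)⁻¹)
    ((hA.measurable α β i j).aestronglyMeasurable.mul hj.1) (Eventually.of_forall fun x => ?_)
  rw [norm_mul]
  exact mul_le_mul_of_nonneg_right (hA.abs_le α β i j x) (norm_nonneg _)

theorem sum_swap_indices {n m : ℕ} (g : Fin n → Fin n → Fin m → Fin m → ℝ) :
    ∑ i, ∑ j, ∑ α, ∑ β, g α β i j = ∑ i, ∑ j, ∑ α, ∑ β, g β α j i := by
  rw [Finset.sum_comm]
  refine Finset.sum_congr rfl fun i _ => Finset.sum_congr rfl fun j _ => ?_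
  rw [Finset.sum_comm]

theorem IsElliptic.adjointCoeff {n m : ℕ} {ν : ℝ} {A : Coeff n m} (hA : IsElliptic ν A) :
    IsElliptic ν (adjointCoeff A) where
  measurable α β i j := hA.measurable β α j i
  elliptic x ξ := by
    refine (hA.elliptic x ξ).trans (le_of_eq ?_)
    rw [sum_swap_indices]
    simp only [EllipticGreen.adjointCoeff, mul_right_comm]
  bounded x := by
    refine le_trans (le_of_eq ?_) (hA.bounded x)
    rw [sum_swap_indices]
    rfl

theorem tendsto_integral_inner_of_tendsto_sub {X V : Type*} [MeasurableSpace X]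
    [NormedAddCommGroup V] [InnerProductSpace ℝ V] {μ : Measure X} {f : X → V} {w : ℕ → X → V}
    {g : X → V} (hf : MemLp f 2 μ) (hw : ∀ k, MemLp (w k) 2 μ) (hg : MemLp g 2 μ)
    (h : Tendsto (fun k => eLpNorm (fun x => w k x - g x) 2 μ) atTop (𝓝 0)) :
    Tendsto (fun k => ∫ x, inner ℝ (f x) (w k x) ∂μ) atTop (𝓝 (∫ x, inner ℝ (f x) (g x) ∂μ)) := by
  rw [tendsto_iff_norm_sub_tendsto_zero]
  have h' : Tendsto (fun k => (eLpNorm f 2 μ).toReal * (eLpNorm (fun x => w k x - g x) 2 μ).toReal)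
      atTop (𝓝 0) := by
    simpa using ((ENNReal.tendsto_toReal ENNReal.zero_ne_top).comp h).const_mul
      (eLpNorm f 2 μ).toReal
  refine squeeze_zero (fun _ => norm_nonneg _) (fun k => ?_) h'
  rw [← integral_sub (integrable_inner_of_memLp hf (hw k)) (integrable_inner_of_memLp hf hg)]
  simp_rw [← inner_sub_right]
  exact abs_integral_inner_le hf ((hw k).sub hg)

/-- The energy estimate: if the functional `φ ↦ ∫ A^{αβ}_{ij} D_β u^j D_α φ^i` is bounded by
`K ‖Dφ‖₂` for test functions, then `ν ‖Du‖₂² ≤ K ‖Du‖₂`. -/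
theorem IsElliptic.energy_le {n m : ℕ} {ν : ℝ} {A : Coeff n m} (hA : IsElliptic ν A)
    {Ω : Set (E n)} {u : E n → E m} {Du : Fin n → E n → E m} (h : MemY120With Ω u Du) {K : ℝ}
    (hK : ∀ φ : E n → E m, IsTest Ω φ → bilinForm A Ω Du φ ≤
      K * ∑ α, (eLpNorm (partialDeriv α φ) 2 (volume.restrict Ω)).toReal) :
    ν * ∑ α, (eLpNorm (Du α) 2 (volume.restrict Ω)).toReal ^ 2 ≤
      K * ∑ α, (eLpNorm (Du α) 2 (volume.restrict Ω)).toReal := by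
  obtain ⟨h1, φ, hφ, h3⟩ := h
  have hF : ∀ α, MemLp (flux A Du α) 2 (volume.restrict Ω) := hA.memLp_flux h1.2.2
  have hlim : Tendsto (fun k => bilinForm A Ω Du (φ k)) atTop
      (𝓝 (∑ α, ∫ x in Ω, inner ℝ (flux A Du α x) (Du α x))) := by
    have he : ∀ k, bilinForm A Ω Du (φ k) =
        ∑ α, ∫ x in Ω, inner ℝ (flux A Du α x) (partialDeriv α (φ k) x) := fun k => by
      rw [bilinForm_eq_integral_flux, integral_finsetSum]
      exact fun α _ => integrable_inner_of_memLp (hF α) ((hφ k).memLp_partialDeriv α _ _)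
    simp_rw [he]
    exact tendsto_finsetSum _ fun α _ => tendsto_integral_inner_of_tendsto_sub (hF α)
      (fun k => (hφ k).memLp_partialDeriv α _ _) (h1.2.2 α) (h3.2 α)
  have hle : ∑ α, ∫ x in Ω, inner ℝ (flux A Du α x) (Du α x) ≤
      K * ∑ α, (eLpNorm (Du α) 2 (volume.restrict Ω)).toReal := by
    refine le_of_tendsto_of_tendsto' hlim ?_ fun k => hK (φ k) (hφ k)
    refine Tendsto.const_mul K (tendsto_finsetSum _ fun α _ => ?_)
    exact (ENNReal.tendsto_toReal (h1.2.2 α).2.ne).comp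
      (h3.eLpNorm_partialDeriv_tendsto h1 hφ α)
  refine le_trans ?_ hle
  simp_rw [fun α => sq_eLpNorm_two_toReal (h1.2.2 α)]
  rw [← integral_finsetSum _ fun α _ => (h1.2.2 α).integrable_norm_pow (by norm_num),
    ← integral_const_mul, ← integral_finsetSum _ fun α _ =>
      integrable_inner_of_memLp (hF α) (h1.2.2 α)]
  refine integral_mono ?_ ?_ fun x => ?_
  · exact (integrable_finsetSum _ fun α _ =>
      (h1.2.2 α).integrable_norm_pow (by norm_num)).const_mul _
  · exact integrable_finsetSum _ fun α _ => integrable_inner_of_memLp (hF α) (h1.2.2 α)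
  · simp only
    rw [sum_inner_flux A Du fun α => Du α x]
    refine le_trans (le_of_eq ?_) (hA.elliptic x fun i α => Du α x i)
    simp_rw [EuclideanSpace.real_norm_sq_eq]
    rw [Finset.sum_comm]

theorem sum_le_of_mul_sum_sq_le {n : ℕ} {ν K : ℝ} (hν : 0 < ν) (hK : 0 ≤ K) {a : Fin n → ℝ}
    (ha : ∀ α, 0 ≤ a α) (h : ν * ∑ α, a α ^ 2 ≤ K * ∑ α, a α) : ∑ α, a α ≤ n * K / ν := by
  have hcs : (∑ α, a α) ^ 2 ≤ n * ∑ α, a α ^ 2 := by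
    simpa using sq_sum_le_card_mul_sum_sq (s := Finset.univ) (f := a)
  have hs : 0 ≤ ∑ α, a α := Finset.sum_nonneg fun α _ => ha α
  rcases hs.eq_or_lt with h0 | h0
  · rw [← h0]; positivity
  · rw [le_div_iff₀ hν]
    refine le_of_mul_le_mul_right ?_ h0
    nlinarith [mul_le_mul_of_nonneg_left hcs hν.le,
      mul_le_mul_of_nonneg_left h (Nat.cast_nonneg (α := ℝ) n)]

theorem SolvesWith.bilinForm_le {n m : ℕ} (hn : 3 ≤ n) {A : Coeff n m} {Ω : Set (E n)}
    {Du : Fin n → E n → E m} {f : E n → E m} (h : SolvesWith A Ω Du f) {x₀ : E n} {r : ℝ}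
    (hr : 0 < r) (hf : MemLp f 2 (volume.restrict (Ω ∩ ball x₀ r)))
    (hf0 : ∀ x ∉ Ω ∩ ball x₀ r, f x = 0) {φ : E n → E m} (hφ : IsTest Ω φ) :
    bilinForm A Ω Du φ ≤
      ((eLpNorm f 2 (volume.restrict (Ω ∩ ball x₀ r))).toReal *
        (unitBallConst n * r * sobolevConst n m)) *
        ∑ α, (eLpNorm (partialDeriv α φ) 2 (volume.restrict Ω)).toReal := by
  set V := Ω ∩ ball x₀ r with hV
  have e1 : bilinForm A Ω Du φ = ∫ x in V, inner ℝ (f x) (φ x) := by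
    rw [h φ hφ, setIntegral_eq_setIntegral_of_subset (inter_subset_left : V ⊆ Ω) fun x hx => by
      simp [hf0 x hx]]
    simp_rw [inner_eq_sum]
  have e2 : eLpNorm φ 2 (volume.restrict V) ≤ ENNReal.ofReal (unitBallConst n * r) *
      (ENNReal.ofReal (sobolevConst n m) *
        ∑ α, eLpNorm (partialDeriv α φ) 2 (volume.restrict Ω)) := by
    refine (eLpNorm_two_le_sobolevExp hn hr inter_subset_right
      hφ.1.continuous.aestronglyMeasurable).trans (mul_le_mul_right ?_ _)
    exact (eLpNorm_mono_measure _ (Measure.restrict_mono_set _ inter_subset_left)).trans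
      (hφ.eLpNorm_sobolevExp_le hn)
  have hfin : ∀ α, eLpNorm (partialDeriv α φ) 2 (volume.restrict Ω) ≠ ⊤ := fun α =>
    (hφ.memLp_partialDeriv α 2 (volume.restrict Ω)).2.ne
  have e3 := ENNReal.toReal_mono (ENNReal.mul_ne_top ENNReal.ofReal_ne_top
    (ENNReal.mul_ne_top ENNReal.ofReal_ne_top (ENNReal.sum_ne_top.2 fun α _ => hfin α))) e2
  rw [ENNReal.toReal_mul, ENNReal.toReal_mul, ENNReal.toReal_sum fun α _ => hfin α,
    ENNReal.toReal_ofReal (mul_nonneg (unitBallConst_nonneg n) hr.le),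
    ENNReal.toReal_ofReal (sobolevConst_nonneg n m)] at e3
  rw [e1]
  refine (le_abs_self _).trans ((abs_integral_inner_le hf (hφ.memLp 2 _)).trans ?_)
  refine (mul_le_mul_of_nonneg_left e3 ENNReal.toReal_nonneg).trans (le_of_eq ?_)
  ring

/-- The constant in the bound of the solution operator from `L²` to `L^{2n/(n-2)}`. -/
noncomputable def solutionConst (n m : ℕ) (ν : ℝ) : ℝ :=
  sobolevConst n m * (n * (unitBallConst n * sobolevConst n m) / ν)

theorem solutionConst_nonneg (n m : ℕ) {ν : ℝ} (hν : 0 < ν) : 0 ≤ solutionConst n m ν := by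
  have := sobolevConst_nonneg n m
  have := unitBallConst_nonneg n
  unfold solutionConst
  positivity

theorem eLpNorm_solution_le {n m : ℕ} (hn : 3 ≤ n) {ν : ℝ} (hν : 0 < ν) {A : Coeff n m}
    (hA : IsElliptic ν A) {Ω : Set (E n)} {u : E n → E m} {Du : Fin n → E n → E m}
    (hu : MemY120With Ω u Du) {f : E n → E m} (h : SolvesWith A Ω Du f) {x₀ : E n} {r : ℝ}
    (hr : 0 < r) (hf : MemLp f 2 (volume.restrict (Ω ∩ ball x₀ r)))
    (hf0 : ∀ x ∉ Ω ∩ ball x₀ r, f x = 0) :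
    eLpNorm u (sobolevExp n) (volume.restrict Ω) ≤ ENNReal.ofReal
      (solutionConst n m ν * r * (eLpNorm f 2 (volume.restrict (Ω ∩ ball x₀ r))).toReal) := by
  have hS := sobolevConst_nonneg n m
  have hc := unitBallConst_nonneg n
  have h1 := hA.energy_le hu fun φ hφ => h.bilinForm_le hn hr hf hf0 hφ
  have h2 := sum_le_of_mul_sum_sq_le hν (by positivity) (fun α => ENNReal.toReal_nonneg) h1
  refine (hu.eLpNorm_sobolevExp_le hn).trans ?_
  have hfin : ∀ α, eLpNorm (Du α) 2 (volume.restrict Ω) ≠ ⊤ := fun α => (hu.1.2.2 α).2.ne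
  rw [← ENNReal.toReal_sum fun α _ => hfin α] at h2
  rw [← ENNReal.ofReal_toReal (ENNReal.sum_ne_top.2 fun α _ => hfin α),
    ← ENNReal.ofReal_mul hS]
  refine ENNReal.ofReal_le_ofReal ((mul_le_mul_of_nonneg_left h2 hS).trans (le_of_eq ?_))
  rw [solutionConst]
  ring

end Energy

end EllipticGreen

namespace EllipticGreen

section Duality

theorem ConditionLB.eLpNorm_top_le {n m : ℕ} {A : Coeff n m} {Ω : Set (E n)} {Rmax : ℝ≥0∞}
    {N₀ : ℝ} (hLB : ConditionLB A Ω Rmax N₀) (hN₀ : 0 < N₀) {x : E n} (hx : x ∈ Ω) {r : ℝ}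
    (hr : 0 < r) (hrR : ENNReal.ofReal r < Rmax) {u : E n → E m}
    (hu : IsWeakSolution A (Ω ∩ ball x r) 0 u ∨
      IsWeakSolution (adjointCoeff A) (Ω ∩ ball x r) 0 u)
    (hv : VanishesOn (Ω ∩ ball x r) (frontier Ω ∩ ball x r) u) {M : ℝ}
    (hM : eLpNorm u 2 (volume.restrict (Ω ∩ ball x r)) ≤ ENNReal.ofReal M) :
    eLpNorm u ⊤ (volume.restrict (Ω ∩ ball x (r / 2))) ≤
      ENNReal.ofReal (N₀ * (r ^ (-(n : ℝ) / 2) * M)) := by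
  refine (hLB x hx r hr hrR 0 MemLp.zero u hu hv).trans ?_
  rw [eLpNorm_zero, mul_zero, add_zero, ENNReal.ofReal_mul hN₀.le,
    ENNReal.ofReal_mul (by positivity)]
  exact mul_le_mul_right (mul_le_mul_right hM _) _

/-- The constant in the bound of potentials away from the support of the density. -/
noncomputable def potentialConst (n m : ℕ) (ν N₀ : ℝ) : ℝ :=
  N₀ * (unitBallConst n * solutionConst n m ν)

theorem potentialConst_nonneg (n m : ℕ) {ν N₀ : ℝ} (hν : 0 < ν) (hN₀ : 0 < N₀) :
    0 ≤ potentialConst n m ν N₀ :=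
  mul_nonneg hN₀.le (mul_nonneg (unitBallConst_nonneg n) (solutionConst_nonneg n m hν))

theorem rpow_neg_half_mul_sq (n : ℕ) {r : ℝ} (hr : 0 < r) :
    r ^ (-(n : ℝ) / 2) * r ^ 2 = r ^ (2 - (n : ℝ) / 2) := by
  rw [← Real.rpow_natCast, ← Real.rpow_add hr]
  congr 1
  push_cast
  ring

theorem memLinftyC_of_eq_zero_off_ball {n m : ℕ} {Ω : Set (E n)} {x₀ : E n} {r : ℝ}
    {f : E n → E m} (hf : MemLp f ⊤ (volume.restrict Ω)) (hf0 : ∀ x ∉ Ω ∩ ball x₀ r, f x = 0) :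
    MemLinftyC Ω f := by
  refine ⟨hf, (isCompact_closedBall x₀ r).of_isClosed_subset isClosed_closure ?_⟩
  refine closure_minimal (fun x hx => ?_) isClosed_closedBall
  by_contra hxb
  exact hx.1 (hf0 x fun h => hxb (ball_subset_closedBall h.2))

theorem eLpNorm_greenPotential_le {n m : ℕ} (hn : 3 ≤ n) {ν N₀ : ℝ} (hν : 0 < ν) (hN₀ : 0 < N₀)
    {Ω : Set (E n)} (hΩ : IsOpen Ω) {A : Coeff n m} (hA : IsElliptic ν A) {Rmax : ℝ≥0∞}
    (hLB : ConditionLB A Ω Rmax N₀) {G : E n → E n → Matrix (Fin m) (Fin m) ℝ}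
    (hG : IsGreenMatrix A Ω G) {x₀ y₀ : E n} (hy₀ : y₀ ∈ Ω) {r : ℝ} (hr : 0 < r)
    (hrR : ENNReal.ofReal r < Rmax) (hd : 2 * r ≤ dist x₀ y₀) {f : E n → E m}
    (hf : MemLp f ⊤ (volume.restrict Ω)) (hf2 : MemLp f 2 (volume.restrict (Ω ∩ ball x₀ r)))
    (hf0 : ∀ x ∉ Ω ∩ ball x₀ r, f x = 0) :
    eLpNorm (greenPotential G Ω f) ⊤ (volume.restrict (Ω ∩ ball y₀ (r / 2))) ≤
      ENNReal.ofReal (potentialConst n m ν N₀ * r ^ (2 - (n : ℝ) / 2) *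
        (eLpNorm f 2 (volume.restrict (Ω ∩ ball x₀ r))).toReal) := by
  obtain ⟨Du, hu, hs⟩ := hG.potential f (memLinftyC_of_eq_zero_off_ball hf hf0)
  have hsub : Ω ∩ ball y₀ r ⊆ Ω := inter_subset_left
  have hdisj : Disjoint (ball x₀ r) (ball y₀ r) := ball_disjoint_ball (by linarith)
  have hw : MemW12With (Ω ∩ ball y₀ r) (greenPotential G Ω f) Du :=
    (hu.1.mono hsub).memW12With hn inter_subset_right
  have hsol : SolvesWith (EllipticGreen.adjointCoeff A) (Ω ∩ ball y₀ r) Du 0 :=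
    hs.mono hsub fun x hx => hf0 x fun h => disjoint_left.1 hdisj h.2 hx.2
  have hM : eLpNorm (greenPotential G Ω f) 2 (volume.restrict (Ω ∩ ball y₀ r)) ≤
      ENNReal.ofReal (unitBallConst n * r * (solutionConst n m ν * r *
        (eLpNorm f 2 (volume.restrict (Ω ∩ ball x₀ r))).toReal)) := by
    refine (eLpNorm_two_le_sobolevExp hn hr inter_subset_right hw.2.1.1).trans ?_
    rw [ENNReal.ofReal_mul (mul_nonneg (unitBallConst_nonneg n) hr.le)]
    refine mul_le_mul_right ?_ _
    exact (eLpNorm_mono_measure _ (Measure.restrict_mono_set _ hsub)).trans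
      (eLpNorm_solution_le hn hν hA.adjointCoeff hu hs hr hf2 hf0)
  refine (hLB.eLpNorm_top_le hN₀ hy₀ hr hrR (Or.inr ⟨Du, hw, hsol⟩)
    ((hu.vanishesOn hΩ).mono hsub inter_subset_left) hM).trans (le_of_eq ?_)
  rw [← rpow_neg_half_mul_sq n hr, potentialConst]
  ring_nf

theorem ae_norm_le_of_eLpNorm_top_le {X V : Type*} [MeasurableSpace X] [NormedAddCommGroup V]
    {μ : Measure X} {f : X → V} {M : ℝ} (hM : 0 ≤ M)
    (h : eLpNorm f ⊤ μ ≤ ENNReal.ofReal M) : ∀ᵐ x ∂μ, ‖f x‖ ≤ M := by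
  rw [eLpNorm_exponent_top] at h
  filter_upwards [ae_le_eLpNormEssSup (f := f) (μ := μ)] with x hx
  have := hx.trans h
  rwa [← ofReal_norm, ENNReal.ofReal_le_ofReal_iff hM] at this

theorem norm_le_of_tendsto_average {n m : ℕ} {Ω : Set (E n)} (hΩ : IsOpen Ω) {y : E n}
    (hy : y ∈ Ω) {u : E n → E m} {r M : ℝ} (hr : 0 < r)
    (hu : Tendsto (fun ρ : ℝ => ⨍ z in ball y ρ, u z) (𝓝[>] 0) (𝓝 (u y)))
    (hM : ∀ᵐ z ∂(volume.restrict (Ω ∩ ball y r)), ‖u z‖ ≤ M) : ‖u y‖ ≤ M := by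
  refine le_of_tendsto hu.norm ?_
  obtain ⟨ε, hε, hball⟩ := Metric.isOpen_iff.1 hΩ y hy
  have hev : ∀ᶠ ρ : ℝ in 𝓝[>] 0, ρ ∈ Ioo 0 (min ε r) :=
    Ioo_mem_nhdsGT (lt_min hε hr)
  filter_upwards [hev] with ρ hρ
  have hsub : ball y ρ ⊆ Ω ∩ ball y r := subset_inter
    ((ball_subset_ball (hρ.2.le.trans (min_le_left _ _))).trans hball)
    (ball_subset_ball (hρ.2.le.trans (min_le_right _ _)))
  have hpos : 0 < volume.real (ball y ρ) :=
    ENNReal.toReal_pos (measure_ball_pos _ _ hρ.1).ne' measure_ball_lt_top.ne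
  rw [setAverage_eq, norm_smul, norm_inv, Real.norm_of_nonneg hpos.le, inv_mul_le_iff₀ hpos,
    mul_comm]
  exact norm_setIntegral_le_of_norm_le_const_ae measure_ball_lt_top
    (ae_restrict_of_ae_restrict_of_subset hsub hM)

theorem exists_countable_dense_bounded {n m : ℕ} (V : Set (E n)) :
    ∃ F : Set (Lp (E m) 2 (volume.restrict V)), F.Countable ∧ Dense F ∧
      ∀ f ∈ F, MemLp f ⊤ (volume.restrict V) := by
  have : Fact ((2 : ℝ≥0∞) ≠ ⊤) := ⟨ENNReal.ofNat_ne_top⟩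
  have hd : Dense {f : Lp (E m) 2 (volume.restrict V) | MemLp f ⊤ (volume.restrict V)} := by
    refine (Lp.simpleFunc.dense (E := E m) (μ := volume.restrict V)
      (ENNReal.ofNat_ne_top (n := 2))).mono fun f hf => ?_
    exact (SimpleFunc.memLp_top _ _).ae_eq (Lp.simpleFunc.toSimpleFunc_eq_toFun ⟨f, hf⟩)
  obtain ⟨F, hF, hc, hFd⟩ := hd.exists_countable_dense_subset
  exact ⟨F, hc, hFd, fun f hf => hF hf⟩

theorem eLpNorm_two_le_of_dense {X V : Type*} [MeasurableSpace X] {μ : Measure X}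
    [NormedAddCommGroup V] [InnerProductSpace ℝ V] {g : X → V} (hg : MemLp g 2 μ)
    {F : Set (Lp V 2 μ)} (hF : Dense F) {M : ℝ} (hM : 0 ≤ M)
    (h : ∀ f ∈ F, ∫ x, inner ℝ (f x) (g x) ∂μ ≤ M * ‖f‖) :
    eLpNorm g 2 μ ≤ ENNReal.ofReal M := by
  have hin : ∀ f : Lp V 2 μ, inner ℝ f (hg.toLp g) = ∫ x, inner ℝ (f x) (g x) ∂μ := fun f => by
    rw [L2.inner_def]
    refine integral_congr_ae ?_
    filter_upwards [hg.coeFn_toLp] with x hx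
    rw [hx]
  have hall : ∀ f : Lp V 2 μ, inner ℝ f (hg.toLp g) ≤ M * ‖f‖ := by
    intro f
    refine hF.induction (P := fun f => inner ℝ f (hg.toLp g) ≤ M * ‖f‖) (fun f hf => ?_) ?_ f
    · rw [hin]; exact h f hf
    · exact isClosed_le (continuous_id.inner continuous_const) (continuous_const.mul continuous_norm)
  have hself := hall (hg.toLp g)
  rw [real_inner_self_eq_norm_sq] at hself
  have hle : ‖hg.toLp g‖ ≤ M := by
    rcases (norm_nonneg (hg.toLp g)).eq_or_lt with h0 | h0
    · rw [← h0]; exact hM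
    · nlinarith
  rw [Lp.norm_toLp] at hle
  exact (ENNReal.ofReal_toReal hg.2.ne).symm.le.trans (ENNReal.ofReal_le_ofReal hle)

theorem ball_inter_subset_diff_closedBall {n : ℕ} {Ω : Set (E n)} {x₀ y : E n} {r : ℝ}
    (hd : 2 * r ≤ dist x₀ y) : Ω ∩ ball x₀ r ⊆ Ω \ closedBall y r := by
  refine fun z hz => ⟨hz.1, fun hzy => ?_⟩
  have h1 := mem_ball'.1 hz.2
  have h2 := mem_closedBall.1 hzy
  have := dist_triangle x₀ z y
  linarith

theorem IsGreenMatrix.vanishesOn_ball {n m : ℕ} {A : Coeff n m} {Ω : Set (E n)}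
    {G : E n → E n → Matrix (Fin m) (Fin m) ℝ} (hG : IsGreenMatrix A Ω G) {x₀ y : E n}
    (hy : y ∈ Ω) {r : ℝ} (hr : 0 < r) (hd : 2 * r ≤ dist x₀ y) (k : Fin m) :
    VanishesOn (Ω ∩ ball x₀ r) (frontier Ω ∩ ball x₀ r) (greenColumn G y k) :=
  (hG.vanishes y hy r hr k).mono (ball_inter_subset_diff_closedBall hd) inter_subset_left

theorem IsGreenMatrix.memLp_two {n m : ℕ} (hn : 3 ≤ n) {A : Coeff n m} {Ω : Set (E n)}
    {G : E n → E n → Matrix (Fin m) (Fin m) ℝ} (hG : IsGreenMatrix A Ω G) {x₀ y : E n}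
    (hy : y ∈ Ω) {r : ℝ} (hr : 0 < r) (hd : 2 * r ≤ dist x₀ y) (k : Fin m) :
    MemLp (greenColumn G y k) 2 (volume.restrict (Ω ∩ ball x₀ r)) := by
  obtain ⟨Du, h, -⟩ := hG.vanishesOn_ball hy hr hd k
  exact MemLp.two_of_sobolevExp hn inter_subset_right h.2.1

theorem IsGreenMatrix.isWeakSolution {n m : ℕ} (hn : 3 ≤ n) {A : Coeff n m} {Ω : Set (E n)}
    (hΩ : IsOpen Ω) {G : E n → E n → Matrix (Fin m) (Fin m) ℝ} (hG : IsGreenMatrix A Ω G)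
    {x₀ y : E n} (hy : y ∈ Ω) {r : ℝ} (hr : 0 < r) (hd : 2 * r ≤ dist x₀ y) (k : Fin m) :
    IsWeakSolution A (Ω ∩ ball x₀ r) 0 (greenColumn G y k) := by
  obtain ⟨Du, h, -⟩ := hG.vanishesOn_ball hy hr hd k
  obtain ⟨D, hD, hsol⟩ := hG.fundamental y hy k
  have hsub : Ω ∩ ball x₀ r ⊆ Ω := inter_subset_left
  refine ⟨Du, h.memW12With hn inter_subset_right, fun φ hφ => ?_⟩
  rw [bilinForm_congr A (h.1.ae_unique (hΩ.inter isOpen_ball) (hD.mono hsub)),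
    bilinForm_mono A hsub D hφ, hsol φ (hφ.mono hsub)]
  have hy' : y ∉ tsupport φ := fun hmem => by
    have := mem_ball'.1 (hφ.2.2 hmem).2
    linarith
  simp [image_eq_zero_of_notMem_tsupport hy']

theorem greenPotential_indicator_apply {n m : ℕ} (G : E n → E n → Matrix (Fin m) (Fin m) ℝ)
    {Ω V : Set (E n)} (hV : MeasurableSet V) (hVΩ : V ⊆ Ω) (f : E n → E m) (y : E n)
    (k : Fin m) :
    greenPotential G Ω (V.indicator f) y k =
      ∫ x in V, inner ℝ (f x) (greenColumn G y k x) := by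
  change ∫ x in Ω, ∑ i, G x y i k * V.indicator f x i = _
  rw [← setIntegral_eq_setIntegral_of_subset hVΩ fun x hx => by
    simp [indicator_of_notMem hx]]
  refine setIntegral_congr_fun hV fun x hx => ?_
  simp only [indicator_of_mem hx, inner_eq_sum, greenColumn]
  exact Finset.sum_congr rfl fun i _ => mul_comm _ _

end Duality

end EllipticGreen

namespace EllipticGreen

section PointwiseBound

theorem memLp_indicator_of_memLp_restrict {n m : ℕ} {Ω V : Set (E n)} (hV : MeasurableSet V)
    (hVΩ : V ⊆ Ω) {f : E n → E m} {p : ℝ≥0∞} (hf : MemLp f p (volume.restrict V)) :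
    MemLp (V.indicator f) p (volume.restrict Ω) := by
  rw [memLp_indicator_iff_restrict hV, Measure.restrict_restrict hV,
    inter_eq_self_of_subset_left hVΩ]
  exact hf

theorem ae_norm_greenPotential_indicator_le {n m : ℕ} (hn : 3 ≤ n) {ν N₀ : ℝ} (hν : 0 < ν)
    (hN₀ : 0 < N₀) {Ω : Set (E n)} (hΩ : IsOpen Ω) {A : Coeff n m} (hA : IsElliptic ν A)
    {Rmax : ℝ≥0∞} (hLB : ConditionLB A Ω Rmax N₀) {G : E n → E n → Matrix (Fin m) (Fin m) ℝ}
    (hG : IsGreenMatrix A Ω G) {x₀ y₀ : E n} (hy₀ : y₀ ∈ Ω) {r : ℝ} (hr : 0 < r)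
    (hrR : ENNReal.ofReal r < Rmax) (hd : 2 * r ≤ dist x₀ y₀)
    (f : Lp (E m) 2 (volume.restrict (Ω ∩ ball x₀ r)))
    (hf : MemLp f ⊤ (volume.restrict (Ω ∩ ball x₀ r))) :
    ∀ᵐ y ∂(volume.restrict (Ω ∩ ball y₀ (r / 2))),
      ‖greenPotential G Ω ((Ω ∩ ball x₀ r).indicator f) y‖ ≤
        potentialConst n m ν N₀ * r ^ (2 - (n : ℝ) / 2) * ‖f‖ := by
  have hV : MeasurableSet (Ω ∩ ball x₀ r) := (hΩ.inter isOpen_ball).measurableSet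
  have hae : (Ω ∩ ball x₀ r).indicator f =ᵐ[volume.restrict (Ω ∩ ball x₀ r)] f :=
    indicator_ae_eq_restrict hV
  have hp := potentialConst_nonneg n m hν hN₀
  refine ae_norm_le_of_eLpNorm_top_le (by positivity) ?_
  refine (eLpNorm_greenPotential_le hn hν hN₀ hΩ hA hLB hG hy₀ hr hrR hd
    (memLp_indicator_of_memLp_restrict hV inter_subset_left hf)
    ((Lp.memLp f).ae_eq hae.symm) fun x hx => indicator_of_notMem hx _).trans (le_of_eq ?_)
  rw [eLpNorm_congr_ae hae, Lp.norm_def]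

theorem matrixNorm_le_of_greenColumn {n m : ℕ} {G : E n → E n → Matrix (Fin m) (Fin m) ℝ}
    {x y : E n} {B : ℝ} (hB : 0 ≤ B) (h : ∀ k, ‖greenColumn G y k x‖ ≤ B) :
    matrixNorm (G x y) ≤ Real.sqrt m * B := by
  rw [matrixNorm, ← Real.sqrt_sq hB, ← Real.sqrt_mul (Nat.cast_nonneg m), Finset.sum_comm]
  refine Real.sqrt_le_sqrt ?_
  calc ∑ k, ∑ i, G x y i k ^ 2 = ∑ k, ‖greenColumn G y k x‖ ^ 2 := by
        simp_rw [EuclideanSpace.real_norm_sq_eq]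
        rfl
    _ ≤ ∑ _k : Fin m, B ^ 2 :=
        Finset.sum_le_sum fun k _ => pow_le_pow_left₀ (norm_nonneg _) (h k) 2
    _ = m * B ^ 2 := by simp

theorem ae_matrixNorm_le_of_potential_le {n m : ℕ} (hn : 3 ≤ n) {ν N₀ : ℝ} (hν : 0 < ν)
    (hN₀ : 0 < N₀) {Ω : Set (E n)} (hΩ : IsOpen Ω) {A : Coeff n m}
    {Rmax : ℝ≥0∞} (hLB : ConditionLB A Ω Rmax N₀) {G : E n → E n → Matrix (Fin m) (Fin m) ℝ}
    (hG : IsGreenMatrix A Ω G) {x₀ y : E n} (hx₀ : x₀ ∈ Ω) (hy : y ∈ Ω) {r : ℝ} (hr : 0 < r)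
    (hrR : ENNReal.ofReal r < Rmax) (hd : 2 * r ≤ dist x₀ y)
    {F : Set (Lp (E m) 2 (volume.restrict (Ω ∩ ball x₀ r)))} (hF : Dense F)
    (h : ∀ f ∈ F, ‖greenPotential G Ω ((Ω ∩ ball x₀ r).indicator f) y‖ ≤
      potentialConst n m ν N₀ * r ^ (2 - (n : ℝ) / 2) * ‖f‖) :
    ∀ᵐ x ∂(volume.restrict (Ω ∩ ball x₀ (r / 2))),
      matrixNorm (G x y) ≤
        Real.sqrt m * (N₀ * (potentialConst n m ν N₀ * r ^ (2 - (n : ℝ)))) := by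
  have hp := potentialConst_nonneg n m hν hN₀
  have hV : MeasurableSet (Ω ∩ ball x₀ r) := (hΩ.inter isOpen_ball).measurableSet
  have hcol : ∀ k, ∀ᵐ x ∂(volume.restrict (Ω ∩ ball x₀ (r / 2))),
      ‖greenColumn G y k x‖ ≤ N₀ * (potentialConst n m ν N₀ * r ^ (2 - (n : ℝ))) := by
    intro k
    have hM : eLpNorm (greenColumn G y k) 2 (volume.restrict (Ω ∩ ball x₀ r)) ≤
        ENNReal.ofReal (potentialConst n m ν N₀ * r ^ (2 - (n : ℝ) / 2)) := by
      refine eLpNorm_two_le_of_dense (hG.memLp_two hn hy hr hd k) hF (by positivity)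
        fun f hf => ?_
      rw [← greenPotential_indicator_apply G hV inter_subset_left f y k]
      exact (le_abs_self _).trans ((PiLp.norm_apply_le _ k).trans (h f hf))
    have key := hLB.eLpNorm_top_le hN₀ hx₀ hr hrR
      (Or.inl (hG.isWeakSolution hn hΩ hy hr hd k)) (hG.vanishesOn_ball hy hr hd k) hM
    have hexp : r ^ (-(n : ℝ) / 2) * (potentialConst n m ν N₀ * r ^ (2 - (n : ℝ) / 2)) =
        potentialConst n m ν N₀ * r ^ (2 - (n : ℝ)) := by
      rw [mul_left_comm, ← Real.rpow_add hr]
      congr 2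
      ring
    rw [hexp] at key
    exact ae_norm_le_of_eLpNorm_top_le (by positivity) key
  filter_upwards [ae_all_iff.2 hcol] with x hx
  exact matrixNorm_le_of_greenColumn (by positivity) hx

theorem ae_restrict_imp_of_locally {n : ℕ} {Ω : Set (E n)} (hΩ : IsOpen Ω) {P Q : E n → Prop}
    (h : ∀ y ∈ Ω, Q y → ∃ ε > 0, ∀ᵐ z ∂(volume.restrict (Ω ∩ ball y ε)), P z) :
    ∀ᵐ y ∂(volume.restrict Ω), Q y → P y := by
  rw [ae_restrict_iff' hΩ.measurableSet, ae_iff]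
  refine measure_null_of_locally_null _ fun y hy => ?_
  simp only [mem_ofPred_eq, Classical.not_imp] at hy
  obtain ⟨ε, hε, hP⟩ := h y hy.1 hy.2.1
  refine ⟨{z | ¬(z ∈ Ω → Q z → P z)} ∩ ball y ε,
    inter_mem self_mem_nhdsWithin (mem_nhdsWithin_of_mem_nhds (ball_mem_nhds y hε)), ?_⟩
  rw [ae_restrict_iff' (hΩ.inter isOpen_ball).measurableSet, ae_iff] at hP
  refine measure_mono_null (fun z hz => ?_) hP
  have hz1 := hz.1
  simp only [mem_ofPred_eq, Classical.not_imp] at hz1 ⊢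
  exact ⟨⟨hz1.1, hz.2⟩, hz1.2.2⟩

/-- The constant in the pointwise bound of Green's matrices. -/
noncomputable def greenConst (n m : ℕ) (ν N₀ : ℝ) : ℝ :=
  Real.sqrt m * (N₀ * (potentialConst n m ν N₀ * 5 ^ ((n : ℝ) - 2))) + 1

theorem greenConst_pos (n m : ℕ) {ν N₀ : ℝ} (hν : 0 < ν) (hN₀ : 0 < N₀) :
    0 < greenConst n m ν N₀ := by
  have hp := potentialConst_nonneg n m hν hN₀
  unfold greenConst
  positivity

theorem radius_bound_le_greenConst {n m : ℕ} (hn : 3 ≤ n) {ν N₀ : ℝ} (hν : 0 < ν) (hN₀ : 0 < N₀)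
    {r d : ℝ} (hd : 0 < d) (hdr : d ≤ 5 * r) :
    Real.sqrt m * (N₀ * (potentialConst n m ν N₀ * r ^ (2 - (n : ℝ)))) ≤
      greenConst n m ν N₀ * d ^ (2 - (n : ℝ)) := by
  have hp := potentialConst_nonneg n m hν hN₀
  have hn' : (3 : ℝ) ≤ n := by exact_mod_cast hn
  have h1 : r ^ (2 - (n : ℝ)) ≤ 5 ^ ((n : ℝ) - 2) * d ^ (2 - (n : ℝ)) := by
    calc r ^ (2 - (n : ℝ)) ≤ (d / 5) ^ (2 - (n : ℝ)) :=
          Real.rpow_le_rpow_of_nonpos (by positivity) (by linarith) (by linarith)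
      _ = 5 ^ ((n : ℝ) - 2) * d ^ (2 - (n : ℝ)) := by
          rw [Real.div_rpow hd.le (by norm_num), ← neg_sub (n : ℝ) 2,
            Real.rpow_neg (by norm_num : (0 : ℝ) ≤ 5), div_inv_eq_mul, mul_comm]
  have h2 : 0 ≤ d ^ (2 - (n : ℝ)) := by positivity
  calc Real.sqrt m * (N₀ * (potentialConst n m ν N₀ * r ^ (2 - (n : ℝ))))
      ≤ Real.sqrt m * (N₀ * (potentialConst n m ν N₀ *
          (5 ^ ((n : ℝ) - 2) * d ^ (2 - (n : ℝ))))) := by gcongr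
    _ ≤ greenConst n m ν N₀ * d ^ (2 - (n : ℝ)) := by
        rw [greenConst]
        linarith

theorem ae_matrixNorm_le_of_countable {n m : ℕ} (hn : 3 ≤ n) {ν N₀ : ℝ} (hν : 0 < ν)
    (hN₀ : 0 < N₀) {Ω : Set (E n)} (hΩ : IsOpen Ω) {A : Coeff n m}
    {Rmax : ℝ≥0∞} (hLB : ConditionLB A Ω Rmax N₀) {G : E n → E n → Matrix (Fin m) (Fin m) ℝ}
    (hG : IsGreenMatrix A Ω G) {S : Set (E n)} (hSΩ : S ⊆ Ω) (hS : Ω ⊆ closure S)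
    {F : ∀ (x₀ : E n) (q : ℚ), Set (Lp (E m) 2 (volume.restrict (Ω ∩ ball x₀ (q : ℝ))))}
    (hF : ∀ x₀ q, Dense (F x₀ q)) {y : E n} (hy : y ∈ Ω)
    (h : ∀ x₀ ∈ S, ∀ q : ℚ, 0 < (q : ℝ) → ENNReal.ofReal (q : ℝ) < Rmax → ∀ f ∈ F x₀ q,
      2 * (q : ℝ) ≤ dist x₀ y →
      ‖greenPotential G Ω ((Ω ∩ ball x₀ (q : ℝ)).indicator f) y‖ ≤
        potentialConst n m ν N₀ * (q : ℝ) ^ (2 - (n : ℝ) / 2) * ‖f‖) :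
    ∀ᵐ x ∂(volume.restrict Ω), x ≠ y → edist x y < Rmax →
      matrixNorm (G x y) ≤ greenConst n m ν N₀ * dist x y ^ (2 - (n : ℝ)) := by
  have key : ∀ᵐ x ∂(volume.restrict Ω), (x ≠ y ∧ edist x y < Rmax) →
      matrixNorm (G x y) ≤ greenConst n m ν N₀ * dist x y ^ (2 - (n : ℝ)) := by
    refine ae_restrict_imp_of_locally hΩ fun x hx ⟨hxy, hxR⟩ => ?_
    have hd : 0 < dist x y := dist_pos.2 hxy
    obtain ⟨q, hq1, hq2⟩ := exists_rat_btwn (show dist x y / 4 < dist x y / 3 by linarith)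
    have hq : 0 < (q : ℝ) := by linarith
    obtain ⟨x₀, hx₀S, hx₀⟩ := Metric.mem_closure_iff.1 (hS hx) ((q : ℝ) / 8) (by positivity)
    have hqR : ENNReal.ofReal (q : ℝ) < Rmax := by
      refine lt_of_le_of_lt ?_ hxR
      rw [edist_dist]
      exact ENNReal.ofReal_le_ofReal (by linarith)
    have hdist : 2 * (q : ℝ) ≤ dist x₀ y := by
      have := dist_triangle x x₀ y
      linarith
    refine ⟨(q : ℝ) / 4, by positivity, ?_⟩
    have hsub : Ω ∩ ball x ((q : ℝ) / 4) ⊆ Ω ∩ ball x₀ ((q : ℝ) / 2) :=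
      inter_subset_inter_right _ (ball_subset_ball' (by linarith))
    have hae := ae_restrict_of_ae_restrict_of_subset hsub
      (ae_matrixNorm_le_of_potential_le hn hν hN₀ hΩ hLB hG (hSΩ hx₀S) hy hq hqR hdist
        (hF x₀ q) fun f hf => h x₀ hx₀S q hq hqR f hf hdist)
    filter_upwards [hae, ae_restrict_mem (hΩ.inter isOpen_ball).measurableSet] with z hz hzb
    have hzx := mem_ball.1 hzb.2
    have h1 := dist_triangle z x y
    have h2 := dist_triangle_left x y z
    exact hz.trans (radius_bound_le_greenConst hn hν hN₀ (by linarith) (by linarith))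
  filter_upwards [key] with x hx h1 h2 using hx ⟨h1, h2⟩

theorem ae_ae_matrixNorm_le {n m : ℕ} (hn : 3 ≤ n) {ν N₀ : ℝ} (hν : 0 < ν)
    (hN₀ : 0 < N₀) {Ω : Set (E n)} (hΩ : IsOpen Ω) {A : Coeff n m} (hA : IsElliptic ν A)
    {Rmax : ℝ≥0∞} (hLB : ConditionLB A Ω Rmax N₀) {G : E n → E n → Matrix (Fin m) (Fin m) ℝ}
    (hG : IsGreenMatrix A Ω G) :
    ∀ᵐ y ∂(volume.restrict Ω), ∀ᵐ x ∂(volume.restrict Ω), x ≠ y → edist x y < Rmax →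
      matrixNorm (G x y) ≤ greenConst n m ν N₀ * dist x y ^ (2 - (n : ℝ)) := by
  obtain ⟨S, hSΩ, hSc, hS⟩ :=
    (TopologicalSpace.IsSeparable.of_separableSpace Ω).exists_countable_dense_subset
  choose F hFc hFd hFb using fun (x₀ : E n) (q : ℚ) =>
    exists_countable_dense_bounded (m := m) (Ω ∩ ball x₀ (q : ℝ))
  have hgood : ∀ᵐ y ∂(volume.restrict Ω), ∀ x₀ ∈ S, ∀ q : ℚ, 0 < (q : ℝ) →
      ENNReal.ofReal (q : ℝ) < Rmax → ∀ f ∈ F x₀ q, 2 * (q : ℝ) ≤ dist x₀ y →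
      ‖greenPotential G Ω ((Ω ∩ ball x₀ (q : ℝ)).indicator f) y‖ ≤
        potentialConst n m ν N₀ * (q : ℝ) ^ (2 - (n : ℝ) / 2) * ‖f‖ := by
    refine (ae_ball_iff hSc).2 fun x₀ hx₀ => ae_all_iff.2 fun q => ?_
    simp only [eventually_imp_distrib_left]
    intro hq hqR
    refine (ae_ball_iff (hFc x₀ q)).2 fun f hf => ?_
    refine ae_restrict_imp_of_locally hΩ fun y hy hd => ⟨(q : ℝ) / 2, by positivity, ?_⟩
    exact ae_norm_greenPotential_indicator_le hn hν hN₀ hΩ hA hLB hG hy hq hqR hd f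
      (hFb x₀ q f hf)
  filter_upwards [hgood, ae_restrict_mem hΩ.measurableSet] with y hy hyΩ
  exact ae_matrixNorm_le_of_countable hn hν hN₀ hΩ hLB hG hSΩ hS hFd hyΩ hy

theorem IsPreciseAt.ae_matrixNorm_le {n m : ℕ} (hn : 3 ≤ n) {ν N₀ : ℝ} (hν : 0 < ν)
    (hN₀ : 0 < N₀) {Ω : Set (E n)} (hΩ : IsOpen Ω) {A : Coeff n m} (hA : IsElliptic ν A)
    {Rmax : ℝ≥0∞} (hLB : ConditionLB A Ω Rmax N₀) {G : E n → E n → Matrix (Fin m) (Fin m) ℝ}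
    (hG : IsGreenMatrix A Ω G) {y : E n} (hy : y ∈ Ω) (hp : IsPreciseAt G Ω y) :
    ∀ᵐ x ∂(volume.restrict Ω), x ≠ y → edist x y < Rmax →
      matrixNorm (G x y) ≤ greenConst n m ν N₀ * dist x y ^ (2 - (n : ℝ)) := by
  choose F _ hFd hFb using fun (x₀ : E n) (q : ℚ) =>
    exists_countable_dense_bounded (m := m) (Ω ∩ ball x₀ (q : ℝ))
  refine ae_matrixNorm_le_of_countable hn hν hN₀ hΩ hLB hG Subset.rfl subset_closure hFd hy
    fun x₀ _ q hq hqR f hf hd => ?_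
  refine norm_le_of_tendsto_average hΩ hy (half_pos hq) (hp _ ?_)
    (ae_norm_greenPotential_indicator_le hn hν hN₀ hΩ hA hLB hG hy hq hqR hd f (hFb x₀ q f hf))
  exact memLinftyC_of_eq_zero_off_ball
    (memLp_indicator_of_memLp_restrict (hΩ.inter isOpen_ball).measurableSet inter_subset_left
      (hFb x₀ q f hf)) fun x hx => indicator_of_notMem hx _

end PointwiseBound

section Continuity

theorem continuous_matrixNorm {m : ℕ} :
    Continuous (matrixNorm : Matrix (Fin m) (Fin m) ℝ → ℝ) := by
  unfold matrixNorm
  fun_prop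

theorem le_of_ae_le_of_continuousOn {n : ℕ} {W : Set (E n)} (hW : IsOpen W) {f g : E n → ℝ}
    (hf : ContinuousOn f W) (hg : ContinuousOn g W)
    (h : ∀ᵐ x ∂(volume.restrict W), f x ≤ g x) : ∀ x ∈ W, f x ≤ g x := by
  have heq : EqOn (fun x => max (f x) (g x)) g W := by
    refine Measure.eqOn_open_of_ae_eq (μ := volume) ?_ hW (hf.sup hg) hg
    filter_upwards [h] with x hx using max_eq_right hx
  exact fun x hx => max_eq_right_iff.1 (heq hx)

theorem isOpen_punctured_edist_lt {n : ℕ} {Ω : Set (E n)} (hΩ : IsOpen Ω) (y : E n) (R : ℝ≥0∞) :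
    IsOpen (Ω ∩ {x | x ≠ y ∧ edist x y < R}) :=
  hΩ.inter (isOpen_ne.inter (isOpen_lt (continuous_id.edist continuous_const) continuous_const))

theorem matrixNorm_le_of_isSeparatelyContinuous {n m : ℕ} {Ω : Set (E n)} (hΩ : IsOpen Ω)
    {Rmax : ℝ≥0∞} {G : E n → E n → Matrix (Fin m) (Fin m) ℝ} {C s : ℝ}
    (hG : IsSeparatelyContinuous G Ω)
    (h : ∀ᵐ y ∂(volume.restrict Ω), ∀ᵐ x ∂(volume.restrict Ω), x ≠ y → edist x y < Rmax →
      matrixNorm (G x y) ≤ C * dist x y ^ s) :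
    ∀ x ∈ Ω, ∀ y ∈ Ω, x ≠ y → edist x y < Rmax → matrixNorm (G x y) ≤ C * dist x y ^ s := by
  have hpow : ∀ (W : Set (E n)) (y : E n), (∀ x ∈ W, x ≠ y) →
      ContinuousOn (fun x => C * dist x y ^ s) W := fun W y hW =>
    continuousOn_const.mul ((continuous_id.dist continuous_const).continuousOn.rpow_const
      fun x hx => Or.inl (dist_pos.2 (hW x hx)).ne')
  have h1 : ∀ᵐ y ∂(volume.restrict Ω), ∀ x ∈ Ω, x ≠ y → edist x y < Rmax →
      matrixNorm (G x y) ≤ C * dist x y ^ s := by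
    filter_upwards [h, ae_restrict_mem hΩ.measurableSet] with y hy hyΩ x hx hxy hxR
    have hW := isOpen_punctured_edist_lt hΩ y Rmax
    refine le_of_ae_le_of_continuousOn hW
      (f := fun x => matrixNorm (G x y)) (g := fun x => C * dist x y ^ s)
      (continuous_matrixNorm.comp_continuousOn ((hG.1 y hyΩ).mono fun z hz => ⟨hz.1, hz.2.1⟩))
      (hpow _ y fun z hz => hz.2.1) ?_ x ⟨hx, hxy, hxR⟩
    filter_upwards [ae_restrict_of_ae_restrict_of_subset inter_subset_left hy,
      ae_restrict_mem hW.measurableSet] with z hz hzW using hz hzW.2.1 hzW.2.2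
  intro x hx y hy hxy hxR
  have hW := isOpen_punctured_edist_lt hΩ x Rmax
  have key := le_of_ae_le_of_continuousOn hW
    (f := fun y => matrixNorm (G x y)) (g := fun y => C * dist y x ^ s)
    (continuous_matrixNorm.comp_continuousOn ((hG.2 x hx).mono fun z hz => ⟨hz.1, hz.2.1⟩))
    (hpow _ x fun z hz => hz.2.1) ?_ y ⟨hy, hxy.symm, edist_comm x y ▸ hxR⟩
  · rw [dist_comm]
    exact key
  · filter_upwards [ae_restrict_of_ae_restrict_of_subset inter_subset_left h1,
      ae_restrict_mem hW.measurableSet] with z hz hzW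
    rw [dist_comm]
    exact hz x hx hzW.2.1.symm (edist_comm z x ▸ hzW.2.2)

end Continuity

end EllipticGreen

theorem mainTheorem2 (n m : ℕ) (hn : 3 ≤ n) (ν N₀ : ℝ) (hν : 0 < ν) (hν1 : ν ≤ 1)
    (hN₀ : 0 < N₀) :
    ∃ C : ℝ, 0 < C ∧
      ∀ (Ω : Set (EllipticGreen.E n)) (A : EllipticGreen.Coeff n m) (Rmax : ℝ≥0∞)
        (G : EllipticGreen.E n → EllipticGreen.E n → Matrix (Fin m) (Fin m) ℝ),
        IsOpen Ω → EllipticGreen.IsElliptic ν A → 0 < Rmax →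
        EllipticGreen.ConditionLB A Ω Rmax N₀ → EllipticGreen.IsGreenMatrix A Ω G →
        (∀ᵐ y ∂(volume.restrict Ω), ∀ᵐ x ∂(volume.restrict Ω), x ≠ y → edist x y < Rmax →
            EllipticGreen.matrixNorm (G x y) ≤ C * dist x y ^ (2 - (n : ℝ))) ∧
        (∀ y ∈ Ω, EllipticGreen.IsPreciseAt G Ω y →
          ∀ᵐ x ∂(volume.restrict Ω), x ≠ y → edist x y < Rmax →
            EllipticGreen.matrixNorm (G x y) ≤ C * dist x y ^ (2 - (n : ℝ))) ∧
        (EllipticGreen.IsSeparatelyContinuous G Ω →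
          ∀ x ∈ Ω, ∀ y ∈ Ω, x ≠ y → edist x y < Rmax →
            EllipticGreen.matrixNorm (G x y) ≤ C * dist x y ^ (2 - (n : ℝ))) := by
  refine ⟨EllipticGreen.greenConst n m ν N₀, EllipticGreen.greenConst_pos n m hν hN₀, ?_⟩
  intro Ω A Rmax G hΩ hA _ hLB hG
  have hae := EllipticGreen.ae_ae_matrixNorm_le hn hν hN₀ hΩ hA hLB hG
  exact ⟨hae, fun y hy hp => hp.ae_matrixNorm_le hn hν hN₀ hΩ hA hLB hG hy,
    fun hc => EllipticGreen.matrixNorm_le_of_isSeparatelyContinuous hΩ hc hae⟩
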